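/- Let $m,n$ be positive integers with $n\le m$, let $r$ be a nonnegative integer, and let $X=(x_1,\dots,x_n)$, $Y=(y_1,\dots,y_m)$ and $z$ be commuting indeterminates. Then, as an identity of Laurent polynomials, $$\sum_{\lambda} z^r\,\mathrm{spo}_{\lambda}(X;z)\,\mathrm{spo}_{(r^{m-n})\cup\lambda}(Y;z)=\sum_{j=1}^{m+n+1} z^{\,r+m+n+1-j}\,\mathrm{sp}_{(\underbrace{r,\dots,r}_{j-1},\,\underbrace{r-1,\dots,r-1}_{m+n+1-j})}(X,Y),$$ where $\lambda$ runs over the partitions of length at most $n$ with $\lambda_1\le r$, and $(r^{m-n})\cup\lambda$ is the partition $(\underbrace{r,\dots,r}_{m-n},\lambda_1,\dots,\lambda_n)$. When $r=0$, the terms on the right indexed by a sequence with an entry $-1$ are taken to be $0$. Here, for variables $x_1,\dots,x_N$, $\mathrm{sp}_\alpha(x_1,\dots,x_N)=\sum_T\prod_{i=1}^{N} x_i^{n_i(T)-n_{\bar i}(T)}$, summed over the symplectic tableaux $T$ of shape $\alpha$: fillings of the Young diagram of $\alpha$ by letters of $1<\bar 1<2<\bar 2<\dots<N<\bar N$ that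 weakly increase along rows, strictly increase down columns, and have all entries of row $i$ at least $i$, where $n_a(T)$ is the number of occurrences of $a$ in $T$. Further, $\mathrm{spo}_\alpha(x_1,\dots,x_N;z)=\sum_T z^{n_{1'}(T)}\prod_{i=1}^{N} x_i^{n_i(T)-n_{\bar i}(T)}$, summed over the orthosymplectic tableaux $T$ of shape $\alpha$: fillings by letters of $1<\bar 1<\dots<N<\bar N<1'$ that weakly increase along rows and down columns, in which the entries other than $1'$ form a symplectic tableau and each row contains $1'$ at most once. -/

import Mathlib

open scoped BigOperators

noncomputable section

namespace OrthoSymp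

/-- The cells of the Young diagram of a partition `α = (α 0 ≥ α 1 ≥ ⋯ ≥ α (k - 1))` given by its
row lengths (trailing zeros are allowed): `⟨i, j⟩` is the cell in row `i` and column `j`, both
counted from `0`. -/
abbrev Cell {k : ℕ} (α : Fin k → ℕ) : Type := (i : Fin k) × Fin (α i)

/-- The ordered alphabet `1 < 1̄ < 2 < 2̄ < ⋯ < n < n̄`. The pair `(i, false)` is the letter `i + 1`
and the pair `(i, true)` is its barred version; the order is lexicographic. -/
abbrev SpLetter (n : ℕ) : Type := Fin n ×ₗ Bool

/-- The ordered alphabet `1 < 1̄ < 2 < 2̄ < ⋯ < n < n̄ < 1' < ⋯ < m'`. -/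
abbrev SpoLetter (n m : ℕ) : Type := SpLetter n ⊕ₗ Fin m

/-- Symplectic tableaux of shape `α`: weakly increasing along rows, strictly increasing down
columns, and the entries of the `i`-th row are at least the (unbarred) letter `i`. -/
structure IsSpTableau {k n : ℕ} (α : Fin k → ℕ) (T : Cell α → SpLetter n) : Prop where
  row_weak : ∀ c d : Cell α, c.1 = d.1 → (c.2 : ℕ) < d.2 → T c ≤ T d
  col_strict : ∀ c d : Cell α, (c.2 : ℕ) = d.2 → c.1 < d.1 → T c < T d
  row_bound : ∀ c : Cell α, (c.1 : ℕ) ≤ (ofLex (T c)).1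

/-- Orthosymplectic tableaux of shape `α`. The entries increase weakly along rows and down columns,
so the cells with unprimed entries form a Young diagram; the unprimed part is a symplectic
tableau; the primed part increases strictly along rows (and weakly down columns). -/
structure IsSpoTableau {k n m : ℕ} (α : Fin k → ℕ) (T : Cell α → SpoLetter n m) : Prop where
  row_weak : ∀ c d : Cell α, c.1 = d.1 → (c.2 : ℕ) < d.2 → T c ≤ T d
  col_weak : ∀ c d : Cell α, (c.2 : ℕ) = d.2 → c.1 < d.1 → T c ≤ T d
  col_strict : ∀ (c d : Cell α) (a b : SpLetter n), (c.2 : ℕ) = d.2 → c.1 < d.1 →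
    ofLex (T c) = Sum.inl a → ofLex (T d) = Sum.inl b → a < b
  row_bound : ∀ (c : Cell α) (a : SpLetter n), ofLex (T c) = Sum.inl a →
    (c.1 : ℕ) ≤ (ofLex a).1
  row_strict : ∀ (c d : Cell α) (a b : Fin m), c.1 = d.1 → (c.2 : ℕ) < d.2 →
    ofLex (T c) = Sum.inr a → ofLex (T d) = Sum.inr b → a < b

variable {R : Type*} [CommRing R]

/-- The weight of a letter: `x i` for the letter `i` and `(x i)⁻¹` for the barred letter. -/
def spWeight {n : ℕ} (x : Fin n → Rˣ) (a : SpLetter n) : R :=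
  match ofLex a with
  | (i, false) => ((x i : Rˣ) : R)
  | (i, true) => (((x i)⁻¹ : Rˣ) : R)

/-- The weight of a letter: as before for unprimed letters, and `y j` for the primed letter `j'`. -/
def spoWeight {n m : ℕ} (x : Fin n → Rˣ) (y : Fin m → R) (a : SpoLetter n m) : R :=
  match ofLex a with
  | Sum.inl b => spWeight x b
  | Sum.inr j => y j

open Classical in
/-- The symplectic Schur function `sp_α(x)` of a partition `α`, as the generating function of
symplectic tableaux. -/
def sp {k n : ℕ} (α : Fin k → ℕ) (x : Fin n → Rˣ) : R :=
  ∑ T : Cell α → SpLetter n with IsSpTableau α T, ∏ c, spWeight x (T c)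

open Classical in
/-- The orthosymplectic Schur function `spo_α(x; y)` of a partition `α`, as the generating function
of orthosymplectic tableaux. -/
def spo {k n m : ℕ} (α : Fin k → ℕ) (x : Fin n → Rˣ) (y : Fin m → R) : R :=
  ∑ T : Cell α → SpoLetter n m with IsSpoTableau α T, ∏ c, spoWeight x y (T c)

open Classical in
/-- `sp_α(x)` for an integer sequence `α`, with the usual convention that it is `0` when `α` is not
a partition (that is, not weakly decreasing or with a negative entry). -/
def spInt {k n : ℕ} (α : Fin k → ℤ) (x : Fin n → Rˣ) : R :=
  if Antitone α ∧ ∀ i, 0 ≤ α i then sp (fun i => (α i).toNat) x else 0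

open Classical in
/-- The partitions of length at most `n` all of whose parts are at most `r`. -/
def boxPartitions (n r : ℕ) : Finset (Fin n → ℕ) :=
  {α ∈ Fintype.piFinset fun _ : Fin n => Finset.range (r + 1) | Antitone α}

/-- For `n ≤ m`, the sequence `(r, …, r, α 0, …, α (n - 1))` of length `m`, with `m - n` leading
entries `r`. -/
def prependRows {n : ℕ} (m r : ℕ) (α : Fin n → ℕ) : Fin m → ℕ := fun i =>
  if h : (i : ℕ) < m - n then r else α ⟨(i : ℕ) - (m - n), by have := i.isLt; omega⟩

end OrthoSymp

end

/-! The left side collapses to one rectangle: the sum of `spo α (X; z) * spo (prependRows m r α) (Y;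
z)` over the box equals `spo` of the rectangle with `n + m` rows of length `r` in the variables `(X,
Y)` (`sum_spo_mul_spo`). Deleting the letters `1'` then expands any `spo` into `sp`'s over vertical
strips, and the vertical strips of a rectangle are exactly the shapes on the right
(`pow_mul_spo_rectangle`).

The collapse is an induction that moves one variable at a time from `X` to `Y`. Removing the last
variable from a shape `α` gives a sum over interlacing chains `α, ν, μ` (`spo_branch`).
Complementing with rows of length `r` turns such a chain into the chain `μ, ν, α` of the other
factor with the same weight, so branching the first factor before the move and the second one after
it gives the same sum. When `X` is empty, only the rectangle remains, in permuted variables, and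
symmetry of `spo` finishes.

Both symmetry and branching in an unprimed variable come from a bialternant formula. With `t i = x i
+ (x i)⁻¹` and `l j = α j + N - j` (rows counted from `0`), `spo α` times the Vandermonde product of
the `t i` is the determinant of `u_l(t) + z u_{l-1}(t)` (`spo_mul_vandProd`). For `z = 0` it holds
because tableaux (`sp_branch`) and determinants (`altDet_branch`) obey the same recursion; for
general `z`, both sides expand over the same vertical strips. Since `altDet_branch` holds for all
`z`, dividing by the Vandermonde product gives `spo_branch`. The division needs a domain with
distinct `t i`, so the collapse is proved for generic variables and then specialised
(`exists_generic`). -/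

open scoped BigOperators

noncomputable section

namespace OrthoSymp

/-! ### Chebyshev-type determinants and their one-variable branching. -/

section Determinants

variable {R : Type*} [CommRing R]

/-- The polynomials `u_l(t)` with `u_l(x + x⁻¹) = (x ^ l - x⁻ˡ) / (x - x⁻¹)`. -/
def chebU (t : R) : ℕ → R
  | 0 => 0
  | 1 => 1
  | l + 2 => t * chebU t (l + 1) - chebU t l

/-- `u_l(t) + z u_{l-1}(t)`, with value `0` at `l = 0`. -/
def chebV (z t : R) : ℕ → R
  | 0 => 0
  | l + 1 => chebU t (l + 1) + z * chebU t l

/-- The recurrence is not available one index lower: the value at `0` is set to `0` instead of `-z`,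
so there it fails by `z`. This defect is the source of the factor `1 + z * y` in the branching
weights. -/
lemma chebV_add_three (z t : R) (l : ℕ) :
    chebV z t (l + 3) = t * chebV z t (l + 2) - chebV z t (l + 1) := by
  simp only [chebV, chebU]; ring

lemma chebV_zero_left (t : R) (l : ℕ) : chebV 0 t l = chebU t l := by
  cases l <;> simp [chebV, chebU]

/-- The partial sums `∑_{k < v} x⁻ᵏ (u_k + z u_{k-1})(t)`, where `y = x⁻¹`. -/
def chebSum (y z t : R) (v : ℕ) : R := ∑ k ∈ Finset.range v, y ^ k * chebV z t k

/-- The weight of a pattern whose smallest shifted entry is `v`. -/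
def bottomWeight (y z : R) (v : ℕ) : R := if v ≤ 1 then 1 else 1 + z * y

/-- A Christoffel–Darboux type telescoping: multiplying the partial generating sum by `t - (x + y)`
cancels everything through the three-term recurrence, except the top terms and the boundary term
`bottomWeight`. -/
lemma chebSum_add_bottomWeight {x y : R} (h : x * y = 1) (z t : R) (v : ℕ) :
    (t - (x + y)) * chebSum y z t (v + 1) + bottomWeight y z (v + 1) =
      y ^ v * (chebV z t (v + 1) - y * chebV z t v) := by
  induction v with
  | zero => simp [chebSum, bottomWeight, chebV, chebU]
  | succ v ih =>
    rw [chebSum, Finset.sum_range_succ, ← chebSum]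
    cases v with
    | zero =>
      simp [chebSum, bottomWeight, chebV, chebU]
      linear_combination -h
    | succ v =>
      have e : bottomWeight y z (v + 1 + 1 + 1) = bottomWeight y z (v + 1 + 1) := by
        simp [bottomWeight]
      rw [e, chebV_add_three]
      linear_combination ih - y ^ (v + 1) * chebV z t (v + 2) * h

lemma chebV_step {x y : R} (h : x * y = 1) (z t : R) (v : ℕ) :
    x ^ (v + 2) * chebV z t (v + 1) - x ^ (v + 1) * chebV z t v =
      x ^ (2 * (v + 1)) *
        ((t - (x + y)) * chebSum y z t (v + 1) + bottomWeight y z (v + 1)) := by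
  rw [chebSum_add_bottomWeight h]
  have e : x ^ v * y ^ v = 1 := by rw [← mul_pow, h, one_pow]
  have e2 : x ^ (2 * (v + 1)) = x ^ v * x ^ v * x ^ 2 := by ring
  rw [e2]
  linear_combination (-x ^ v * x ^ 2 * (chebV z t (v + 1) - y * chebV z t v)) * e
    + x ^ (v + 1) * chebV z t v * h

lemma sum_Ico_shift (f : ℕ → R) (a b d : ℕ) :
    ∑ k ∈ Finset.Ico (a + d) (b + d + 1), f k = ∑ k ∈ Finset.Icc a b, f (k + d) := by
  rw [show b + d + 1 = (b + 1) + d by ring, ← Finset.sum_Ico_add', Finset.Ico_add_one_right_eq_Icc]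

/-- Multilinearity of the determinant in its rows. -/
lemma det_row_sum {N : ℕ} (S : Fin N → Finset ℕ) (f : Fin N → ℕ → Fin N → R) :
    (Matrix.of fun j i => ∑ k ∈ S j, f j k i).det =
      ∑ v ∈ Fintype.piFinset S, (Matrix.of fun j i => f j (v j) i).det := by
  have := (Matrix.detRowAlternating (n := Fin N) (R := R)).toMultilinearMap.map_sum_finset f S
  refine Eq.trans ?_ (this.trans ?_)
  · change _ = Matrix.det _
    congr 1
    ext j i
    simp
  · rfl

/-- The determinant is unchanged if from each row the next one is subtracted. -/
lemma det_row_sub_next {N : ℕ} (A B : Matrix (Fin (N + 1)) (Fin (N + 1)) R)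
    (hlast : ∀ i, A (Fin.last N) i = B (Fin.last N) i)
    (hsub : ∀ j : Fin N, ∀ i, B j.castSucc i = A j.castSucc i - A j.succ i) :
    A.det = B.det := by
  -- Reversing the rows turns the next row into the previous one, as the row-operation lemma
  -- requires.
  rw [← Matrix.det_submatrix_equiv_self Fin.revPerm A,
    ← Matrix.det_submatrix_equiv_self Fin.revPerm B]
  refine Matrix.det_eq_of_forall_row_eq_smul_add_pred (fun _ => 1) ?_ ?_
  · intro i; simp [hlast]
  · intro j i
    simp only [Matrix.submatrix_apply, Fin.revPerm_apply, Fin.rev_succ, Fin.rev_castSucc, hsub]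
    ring

/-- After subtracting from each row the next one, either the border column (if `h` is constant) or
the last row (if `F` vanishes there) is zero except for the corner `c`, and the expansion along it
has one term. -/
lemma det_border {N : ℕ} (F : Fin (N + 1) → Fin N → R) (h : Fin (N + 1) → R) (c : R)
    (hlast : h (Fin.last N) = c) (hc : (∀ j, h j = c) ∨ ∀ i, F (Fin.last N) i = 0) :
    (Matrix.of fun j i => Fin.snoc (α := fun _ => R) (F j) (h j) i :
      Matrix (Fin (N + 1)) (Fin (N + 1)) R).det =
      c * (Matrix.of fun j i : Fin N => F j.castSucc i - F j.succ i).det := by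
  set B : Matrix (Fin (N + 1)) (Fin (N + 1)) R := Matrix.of fun j i =>
    Fin.lastCases (motive := fun _ => R) (Fin.snoc (α := fun _ => R) (F (Fin.last N)) (h (Fin.last N)) i)
      (fun j => Fin.snoc (α := fun _ => R) (F j.castSucc) (h j.castSucc) i -
        Fin.snoc (α := fun _ => R) (F j.succ) (h j.succ) i) j with hB
  rw [det_row_sub_next _ B (by simp [hB]) (by simp [hB])]
  have hminor : (B.submatrix Fin.castSucc Fin.castSucc) =
      Matrix.of fun j i : Fin N => F j.castSucc i - F j.succ i := by
    ext j i; simp [hB]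
  have hcorner : B (Fin.last N) (Fin.last N) = c := by simp [hB, hlast]
  rcases hc with hc | hc
  · rw [Matrix.det_succ_column B (Fin.last N), Fin.sum_univ_castSucc, Finset.sum_eq_zero]
    · simp only [Fin.succAbove_last, zero_add, hminor, hcorner]
      rw [← two_mul, pow_mul]; simp
    · intro j _
      simp [hB, hc]
  · rw [Matrix.det_succ_row B (Fin.last N), Fin.sum_univ_castSucc, Finset.sum_eq_zero]
    · simp only [Fin.succAbove_last, zero_add, hminor, hcorner]
      rw [← two_mul, pow_mul]; simp
    · intro j _
      simp [hB, hc]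

/-- The sequences `ν` with `α 0 ≥ ν 0 ≥ α 1 ≥ ν 1 ≥ ⋯ ≥ α N ≥ ν N ≥ 0`. -/
def upperStrip {N : ℕ} (α : Fin (N + 1) → ℕ) : Finset (Fin (N + 1) → ℕ) :=
  Fintype.piFinset fun j =>
    Finset.Icc (Fin.snoc (α := fun _ => ℕ) (fun i : Fin N => α i.succ) 0 j) (α j)

/-- The sequences `μ` with `ν 0 ≥ μ 0 ≥ ν 1 ≥ ⋯ ≥ μ (N - 1) ≥ ν N`. -/
def lowerStrip {N : ℕ} (ν : Fin (N + 1) → ℕ) : Finset (Fin N → ℕ) :=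
  Fintype.piFinset fun j => Finset.Icc (ν j.succ) (ν j.castSucc)

lemma mem_upperStrip {N : ℕ} {α ν : Fin (N + 1) → ℕ} :
    ν ∈ upperStrip α ↔ (∀ j, ν j ≤ α j) ∧ ∀ j : Fin N, α j.succ ≤ ν j.castSucc := by
  simp only [upperStrip, Fintype.mem_piFinset, Finset.mem_Icc]
  refine ⟨fun h => ⟨fun j => (h j).2, fun j => by simpa using (h j.castSucc).1⟩, fun h j => ⟨?_, h.1 j⟩⟩
  refine Fin.lastCases ?_ (fun j => ?_) j
  · simp
  · simpa using h.2 j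

lemma mem_lowerStrip {N : ℕ} {ν : Fin (N + 1) → ℕ} {μ : Fin N → ℕ} :
    μ ∈ lowerStrip ν ↔ ∀ j, ν j.succ ≤ μ j ∧ μ j ≤ ν j.castSucc := by
  simp [lowerStrip]

lemma antitone_of_mem_upperStrip {N : ℕ} {α ν : Fin (N + 1) → ℕ} (h : ν ∈ upperStrip α) :
    Antitone ν := by
  rw [mem_upperStrip] at h
  exact Fin.antitone_iff_succ_le.2 fun j => (h.1 _).trans (h.2 j)

lemma antitone_of_mem_lowerStrip {N : ℕ} {ν : Fin (N + 1) → ℕ} {μ : Fin N → ℕ}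
    (h : μ ∈ lowerStrip ν) : Antitone μ := by
  rw [mem_lowerStrip] at h
  cases N with
  | zero => exact fun i => i.elim0
  | succ N => exact Fin.antitone_iff_succ_le.2 fun j => (h j.succ).2.trans (h j.castSucc).1

/-- The numerator determinant `det (u_{l_j}(t_i) + z u_{l_j - 1}(t_i))`, where `l = α + δ`. -/
def altDet {N : ℕ} (z : R) (α : Fin N → ℕ) (t : Fin N → R) : R :=
  (Matrix.of fun j i => chebV z (t i) (α j + (N - j))).det

lemma altDet_comp_perm {N : ℕ} (z : R) (α : Fin N → ℕ) (t : Fin N → R) (σ : Equiv.Perm (Fin N)) :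
    altDet z α (t ∘ σ) = (Equiv.Perm.sign σ : ℤ) * altDet z α t :=
  Matrix.det_permute' σ (Matrix.of fun j i => chebV z (t i) (α j + (N - j)))

/-- The weight of the one-variable branching step `α → ν → μ`. -/
def branchWeight {N : ℕ} (x y z : R) (α ν : Fin (N + 1) → ℕ) (μ : Fin N → ℕ) : R :=
  (∏ j, (x ^ (2 * ν j) * y ^ α j)) * (∏ j, y ^ μ j) * (if ν (Fin.last N) = 0 then 1 else 1 + z * y)

/-- Each entry is a sum over an interval of indices; after removing the shift `N - j`, choosing one
index per row is exactly choosing `μ` interlacing `ν`. -/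
lemma det_chebSum_sub {N : ℕ} (y z : R) (ν : Fin (N + 1) → ℕ) (hν : Antitone ν) (t : Fin N → R) :
    (Matrix.of fun j i : Fin N =>
        chebSum y z (t i) (ν j.castSucc + (N - j) + 1) - chebSum y z (t i) (ν j.succ + (N - j))).det =
      ∑ μ ∈ lowerStrip ν, (∏ j : Fin N, y ^ (μ j + (N - j))) * altDet z μ t := by
  have e : (Matrix.of fun j i : Fin N =>
        chebSum y z (t i) (ν j.castSucc + (N - j) + 1) - chebSum y z (t i) (ν j.succ + (N - j))) =
      Matrix.of fun (j i : Fin N) => ∑ k ∈ Finset.Icc (ν j.succ) (ν j.castSucc),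
        y ^ (k + (N - j)) * chebV z (t i) (k + (N - j)) := by
    ext j i
    have := hν (Fin.castSucc_lt_succ (i := j)).le
    simp only [Matrix.of_apply, chebSum]
    rw [← Finset.sum_Ico_eq_sub _ (by omega),
      sum_Ico_shift (fun k => y ^ k * chebV z (t i) k)]
  rw [e, det_row_sum _ fun j k i => y ^ (k + (N - j)) * chebV z (t i) (k + (N - j))]
  refine Finset.sum_congr rfl fun μ _ => ?_
  exact Matrix.det_mul_column (fun j : Fin N => y ^ (μ j + (N - j)))
    (Matrix.of fun j i => chebV z (t i) (μ j + (N - j)))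

lemma det_chebV_step {N : ℕ} {x y : R} (h : x * y = 1) (z : R) (ν : Fin (N + 1) → ℕ)
    (hν : Antitone ν) (t : Fin (N + 1) → R) (ht : t (Fin.last N) = x + y) :
    (Matrix.of fun j i : Fin (N + 1) =>
        x ^ (ν j + (N - j) + 2) * chebV z (t i) (ν j + (N - j) + 1) -
          x ^ (ν j + (N - j) + 1) * chebV z (t i) (ν j + (N - j))).det =
      (∏ i : Fin N, (t i.castSucc - (x + y))) * ((∏ j : Fin (N + 1), x ^ (2 * (ν j + (N - j) + 1))) *
        (if ν (Fin.last N) = 0 then 1 else 1 + z * y)) *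
        ∑ μ ∈ lowerStrip ν, (∏ j : Fin N, y ^ (μ j + (N - j))) * altDet z μ (fun i => t i.castSucc) := by
  simp_rw [chebV_step h]
  set M : Matrix (Fin (N + 1)) (Fin (N + 1)) R := Matrix.of fun j i =>
    Fin.snoc (α := fun _ => R) (fun i => chebSum y z (t i.castSucc) (ν j + (N - j) + 1))
      (bottomWeight y z (ν j + (N - j) + 1)) i with hM
  set M' : Matrix (Fin (N + 1)) (Fin (N + 1)) R := Matrix.of fun j i =>
    Fin.snoc (α := fun _ => R) (fun i : Fin N => t i.castSucc - (x + y)) 1 i * M j i with hM'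
  have h1 := Matrix.det_mul_column (fun j : Fin (N + 1) => x ^ (2 * (ν j + (N - j) + 1)))
    (Matrix.of fun j i : Fin (N + 1) => (t i - (x + y)) * chebSum y z (t i) (ν j + (N - j) + 1) +
      bottomWeight y z (ν j + (N - j) + 1))
  have h2 : (Matrix.of fun j i : Fin (N + 1) =>
      (t i - (x + y)) * chebSum y z (t i) (ν j + (N - j) + 1) +
      bottomWeight y z (ν j + (N - j) + 1)).det = M'.det := by
    -- The last column is pure `bottomWeight`, since `t = x + y` there; subtracting it from the
    -- others leaves multiples of `t i - (x + y)`.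
    rw [← Matrix.det_transpose, ← Matrix.det_transpose M']
    refine Matrix.det_eq_of_forall_row_eq_smul_add_const
      (Fin.snoc (α := fun _ => R) (fun _ : Fin N => 1) 0) (Fin.last N) (by simp) ?_
    intro i j
    refine Fin.lastCases ?_ (fun i => ?_) i <;> simp [hM, hM', ht]
  have h3 : M'.det = _ := Matrix.det_mul_row
    (Fin.snoc (α := fun _ => R) (fun i : Fin N => t i.castSucc - (x + y)) 1) M
  have h4 := det_border (fun j i => chebSum y z (t i.castSucc) (ν j + (N - j) + 1))
    (fun j => bottomWeight y z (ν j + (N - j) + 1)) (if ν (Fin.last N) = 0 then 1 else 1 + z * y)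
    (by simp [bottomWeight]) (by
      -- If the smallest part is zero, the last partial sum is empty of nonzero terms; otherwise
      -- every shifted entry exceeds `1` and all the border entries equal `1 + z * y`.
      by_cases h0 : ν (Fin.last N) = 0
      · right; intro i; simp [h0, chebSum, chebV]
      · left; intro j
        have := hν (Fin.le_last j)
        have : ν j ≠ 0 := by omega
        simp [h0, this, bottomWeight])
  have h5 := det_chebSum_sub y z ν hν (fun i => t i.castSucc)
  rw [← h5]
  simp only [Matrix.of_apply] at h1
  have h6 : (∏ i, Fin.snoc (α := fun _ => R) (fun i : Fin N => t i.castSucc - (x + y)) 1 i) =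
      ∏ i : Fin N, (t i.castSucc - (x + y)) := by simp [Fin.prod_univ_castSucc]
  rw [h1, h2, h3, h4, h6]
  simp only [Fin.val_castSucc, Fin.val_succ]
  have e : ∀ j : Fin N, N - (j + 1 : ℕ) + 1 = N - j := fun j => by omega
  simp only [add_assoc, e]
  ring

/-- The staircase shifts of the three sequences cancel, leaving the unshifted weight. -/
lemma shift_weight {N : ℕ} {x y : R} (h : x * y = 1) (α ν : Fin (N + 1) → ℕ) (μ : Fin N → ℕ) :
    (∏ j : Fin (N + 1), y ^ (α j + (N - j) + 2)) * (∏ j : Fin (N + 1), x ^ (2 * (ν j + (N - j) + 1))) *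
      (∏ j : Fin N, y ^ (μ j + (N - j))) =
    (∏ j, (x ^ (2 * ν j) * y ^ α j)) * (∏ j, y ^ μ j) := by
  simp only [Fin.prod_univ_castSucc (n := N), Fin.val_castSucc, Fin.val_last]
  have e : ∀ k, x ^ k * y ^ k = 1 := fun k => by rw [← mul_pow, h, one_pow]
  have key : ∀ j : Fin N, y ^ (α j.castSucc + (N - j) + 2) * x ^ (2 * (ν j.castSucc + (N - j) + 1)) *
      y ^ (μ j + (N - j)) = x ^ (2 * ν j.castSucc) * y ^ α j.castSucc * y ^ μ j := by
    intro j
    linear_combination (x ^ (2 * ν j.castSucc) * y ^ α j.castSucc * y ^ μ j) *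
      e (2 * (N - j + 1))
  have key' := Finset.prod_congr rfl fun j (_ : j ∈ (Finset.univ : Finset (Fin N))) => key j
  simp only [Finset.prod_mul_distrib] at key' ⊢
  simp only [Nat.sub_self, add_zero]
  have e2 : y ^ (α (Fin.last N) + 2) * x ^ (2 * (ν (Fin.last N) + 1)) =
      x ^ (2 * ν (Fin.last N)) * y ^ α (Fin.last N) := by
    linear_combination (x ^ (2 * ν (Fin.last N)) * y ^ α (Fin.last N)) * e 2
  have e3 := congrArg₂ (· * ·) key' e2
  refine Eq.trans ?_ (e3.trans ?_)
  · simp only [mul_assoc, mul_comm, mul_left_comm]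
  · simp only [mul_assoc, mul_comm, mul_left_comm]

/-- One-variable branching of the numerator determinants. -/
theorem altDet_branch {N : ℕ} {x y : R} (h : x * y = 1) (z : R) (α : Fin (N + 1) → ℕ)
    (hα : Antitone α) (t : Fin (N + 1) → R) (ht : t (Fin.last N) = x + y) :
    altDet z α t = (∏ i : Fin N, (t i.castSucc - (x + y))) *
      ∑ ν ∈ upperStrip α, ∑ μ ∈ lowerStrip ν,
        branchWeight x y z α ν μ * altDet z μ (fun i => t i.castSucc) := by
  have h1 := Matrix.det_mul_column (fun j : Fin (N + 1) => x ^ (α j + (N - j) + 2))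
    (Matrix.of fun j i => chebV z (t i) (α j + (N + 1 - j)))
  -- Scaling row `j` by `x ^ (l j + 1)` and subtracting the next row makes each entry a telescoping
  -- sum over `[α (j + 1), α j]`. The last row needs no subtraction: its sum starts at `0`, where
  -- `chebV` vanishes.
  have h2 : (Matrix.of fun j i : Fin (N + 1) =>
      x ^ (α j + (N - j) + 2) * chebV z (t i) (α j + (N + 1 - j))).det =
      (Matrix.of fun j i : Fin (N + 1) => ∑ k ∈ Finset.Icc
        (Fin.snoc (α := fun _ => ℕ) (fun i : Fin N => α i.succ) 0 j) (α j),
        (x ^ (k + (N - j) + 2) * chebV z (t i) (k + (N - j) + 1) -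
          x ^ (k + (N - j) + 1) * chebV z (t i) (k + (N - j)))).det := by
    refine det_row_sub_next _ _ ?_ ?_
    · intro i
      simp only [Matrix.of_apply, Fin.snoc_last]
      rw [← sum_Ico_shift (fun k => x ^ (k + 2) * chebV z (t i) (k + 1) - x ^ (k + 1) * chebV z (t i) k)]
      have := Finset.sum_range_sub (fun k => x ^ (k + 1) * chebV z (t i) k) (α (Fin.last N) + 1)
      simp only [Fin.val_last, Nat.sub_self, add_zero, ← Finset.range_eq_Ico] at this ⊢
      rw [this]
      simp [chebV]
    · intro j i
      simp only [Matrix.of_apply, Fin.snoc_castSucc]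
      rw [← sum_Ico_shift (fun k => x ^ (k + 2) * chebV z (t i) (k + 1) - x ^ (k + 1) * chebV z (t i) k)]
      have hj := hα (Fin.castSucc_lt_succ (i := j)).le
      rw [Finset.sum_Ico_sub (fun k => x ^ (k + 1) * chebV z (t i) k) (by omega)]
      simp only [Fin.val_castSucc, Fin.val_succ]
      rw [show N + 1 - (j : ℕ) = N - j + 1 by omega, show N + 1 - (j + 1 : ℕ) = N - j by omega,
        show α j.succ + (N - (j + 1 : ℕ)) + 2 = α j.succ + (N - j) + 1 by omega]
      rfl
  simp only [Matrix.of_apply] at h1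
  rw [h2, det_row_sum _ fun (j : Fin (N + 1)) k i =>
    (x ^ (k + (N - j) + 2) * chebV z (t i) (k + (N - j) + 1) -
          x ^ (k + (N - j) + 1) * chebV z (t i) (k + (N - j)))] at h1
  have h3 : (∏ j : Fin (N + 1), y ^ (α j + (N - j) + 2)) * (∏ j : Fin (N + 1), x ^ (α j + (N - j) + 2)) = 1 := by
    rw [← Finset.prod_mul_distrib]
    exact Finset.prod_eq_one fun j _ => by rw [← mul_pow, mul_comm y, h, one_pow]
  have h4 : altDet z α t = (∏ j : Fin (N + 1), y ^ (α j + (N - j) + 2)) *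
      ((∏ j : Fin (N + 1), x ^ (α j + (N - j) + 2)) * altDet z α t) := by
    rw [← mul_assoc, h3, one_mul]
  rw [h4, altDet, ← h1, Finset.mul_sum, Finset.mul_sum]
  refine Finset.sum_congr rfl fun ν hν => ?_
  rw [det_chebV_step h z ν (antitone_of_mem_upperStrip hν) t ht, Finset.mul_sum, Finset.mul_sum,
    Finset.mul_sum]
  refine Finset.sum_congr rfl fun μ _ => ?_
  rw [branchWeight, ← shift_weight h]
  ring

end Determinants

/-! ### Branching of symplectic tableaux in the last pair of letters. -/

section Tableaux

variable {R : Type*} [CommRing R]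

/-- The position of a letter in the alphabet `1 < 1̄ < 2 < 2̄ < ⋯`, counted from `0`. -/
def spRank {n : ℕ} (a : SpLetter n) : ℕ := 2 * (ofLex a).1 + if (ofLex a).2 then 1 else 0

lemma spRank_lt {n : ℕ} (a : SpLetter n) : spRank a < 2 * n := by
  have := (ofLex a).1.isLt
  unfold spRank
  split_ifs <;> omega

lemma spRank_div_two {n : ℕ} (a : SpLetter n) : spRank a / 2 = (ofLex a).1 := by
  unfold spRank
  split_ifs <;> omega

lemma spRank_injective {n : ℕ} : Function.Injective (spRank (n := n)) := by
  intro a b h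
  have h1 := spRank_div_two a
  have h2 := spRank_div_two b
  apply ofLex.injective
  have h3 : (ofLex a).1 = (ofLex b).1 := Fin.ext (by omega)
  refine Prod.ext h3 ?_
  unfold spRank at h
  rw [h3] at h
  cases ha : (ofLex a).2 <;> cases hb : (ofLex b).2 <;> simp_all

lemma spRank_lt_iff {n : ℕ} {a b : SpLetter n} : spRank a < spRank b ↔ a < b := by
  rw [Prod.Lex.lt_iff]
  unfold spRank
  rw [Fin.lt_def, Fin.ext_iff]
  generalize ((ofLex a).1 : ℕ) = i
  generalize ((ofLex b).1 : ℕ) = j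
  have htf : ¬ (true < false) := by decide
  cases ha : (ofLex a).2 <;> cases hb : (ofLex b).2 <;> simp [htf] <;> omega

lemma spRank_le_iff {n : ℕ} {a b : SpLetter n} : spRank a ≤ spRank b ↔ a ≤ b := by
  rw [← not_lt, ← not_lt, spRank_lt_iff]

/-- The inclusion of the alphabet of `n` pairs of letters into that of `n + 1` pairs. -/
def spEmbed {n : ℕ} (a : SpLetter n) : SpLetter (n + 1) := toLex ((ofLex a).1.castSucc, (ofLex a).2)

lemma spRank_spEmbed {n : ℕ} (a : SpLetter n) : spRank (spEmbed a) = spRank a := by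
  rfl

lemma exists_spEmbed {n : ℕ} (a : SpLetter (n + 1)) (h : spRank a < 2 * n) :
    ∃ b : SpLetter n, spEmbed b = a := by
  have := spRank_div_two a
  refine ⟨toLex (⟨(ofLex a).1, by omega⟩, (ofLex a).2), rfl⟩

lemma spWeight_spEmbed {n : ℕ} (x : Fin (n + 1) → Rˣ) (a : SpLetter n) :
    spWeight x (spEmbed a) = spWeight (fun i => x i.castSucc) a := by
  obtain ⟨i, b⟩ := a
  cases b <;> rfl

/-- The inclusion of a Young diagram `μ` whose rows are contained in rows of `α`. -/
def cellInc {k l : ℕ} {α : Fin k → ℕ} {μ : Fin l → ℕ} (e : Fin l → Fin k) (h : ∀ i, μ i ≤ α (e i))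
    (d : Cell μ) : Cell α := ⟨e d.1, Fin.castLE (h d.1) d.2⟩

lemma cellInc_injective {k l : ℕ} {α : Fin k → ℕ} {μ : Fin l → ℕ} {e : Fin l → Fin k}
    (he : Function.Injective e) (h : ∀ i, μ i ≤ α (e i)) : Function.Injective (cellInc e h) := by
  rintro ⟨i, j⟩ ⟨i', j'⟩ hc
  simp only [cellInc, Sigma.mk.injEq] at hc
  obtain ⟨h1, h2⟩ := hc
  obtain rfl := he h1
  simpa [Fin.ext_iff] using h2

lemma exists_cellInc {k l : ℕ} {α : Fin k → ℕ} {μ : Fin l → ℕ} {e : Fin l → Fin k}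
    (h : ∀ i, μ i ≤ α (e i)) (c : Cell α) :
    (∃ d : Cell μ, cellInc e h d = c) ↔ ∃ i, e i = c.1 ∧ (c.2 : ℕ) < μ i := by
  obtain ⟨i, j⟩ := c
  constructor
  · rintro ⟨d, hd⟩
    refine ⟨d.1, congrArg Sigma.fst hd, ?_⟩
    rw [← hd]
    exact d.2.isLt
  · rintro ⟨i', rfl, hj⟩
    exact ⟨⟨i', ⟨j, hj⟩⟩, rfl⟩

open Classical in
/-- The filling of the larger diagram which extends `T` by `g`. -/
def extendFilling {C D L M : Type*} (ι : D → C) (f : M → L) (g : C → L) (T : D → M) (c : C) : L :=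
  if h : ∃ d, ι d = c then f (T h.choose) else g c

lemma extendFilling_apply {C D L M : Type*} {ι : D → C} (hι : Function.Injective ι) (f : M → L)
    (g : C → L) (T : D → M) (d : D) : extendFilling ι f g T (ι d) = f (T d) := by
  have h : ∃ d', ι d' = ι d := ⟨d, rfl⟩
  rw [extendFilling, dif_pos h, hι h.choose_spec]

lemma extendFilling_of_not {C D L M : Type*} {ι : D → C} (f : M → L)
    (g : C → L) (T : D → M) {c : C} (h : ¬ ∃ d, ι d = c) : extendFilling ι f g T c = g c := by
  rw [extendFilling, dif_neg h]

open Classical in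
/-- The sum over fillings which extend smaller ones by `g`. -/
lemma sum_extendFilling {C D L M : Type*} [DecidableEq C] [DecidableEq D] [Fintype C] [Fintype D]
    [Fintype L] [Fintype M] {ι : D → C} [∀ c, Decidable (∃ d, ι d = c)] (hι : Function.Injective ι)
    {f : M → L} (hf : Function.Injective f) (g : C → L)
    (w : L → R) (P : (C → L) → Prop) (Q : (D → M) → Prop)
    (hQ : ∀ T, Q T → P (extendFilling ι f g T))
    (hP : ∀ T, P T → ∃ T', Q T' ∧ extendFilling ι f g T' = T) :
    ∑ T : C → L with P T, ∏ c, w (T c) =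
      (∏ c, if ∃ d, ι d = c then 1 else w (g c)) * ∑ T : D → M with Q T, ∏ d, w (f (T d)) := by
  rw [Finset.mul_sum]
  symm
  refine Finset.sum_nbij (extendFilling ι f g) ?_ ?_ ?_ ?_
  · intro T hT
    simpa using hQ T (by simpa using hT)
  · intro T _ T' _ h
    funext d
    have := congrFun h (ι d)
    rw [extendFilling_apply hι, extendFilling_apply hι] at this
    exact hf this
  · intro T hT
    obtain ⟨T', h1, h2⟩ := hP T (by simpa using hT)
    exact ⟨T', by simpa using h1, h2⟩
  · intro T _
    have h1 : ∏ d, w (f (T d)) = ∏ c, if ∃ d, ι d = c then w (extendFilling ι f g T c) else 1 := by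
      rw [← Finset.prod_filter]
      refine Finset.prod_nbij ι ?_ hι.injOn ?_ ?_
      · intro d _; simp
      · intro c hc; simpa using hc
      · intro d _; rw [extendFilling_apply hι]
    rw [h1, ← Finset.prod_mul_distrib]
    refine Finset.prod_congr rfl fun c _ => ?_
    by_cases h : ∃ d, ι d = c
    · simp only [if_pos h, one_mul]
    · simp only [if_neg h, mul_one]
      rw [extendFilling_of_not f g T h]

lemma exists_threshold {a : ℕ} (S : Fin a → Prop) (hS : ∀ i j, i < j → S j → S i) :
    ∃ m ≤ a, ∀ j : Fin a, S j ↔ (j : ℕ) < m := by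
  classical
  by_cases h : ∃ m, ∃ hm : m < a, ¬ S ⟨m, hm⟩
  · refine ⟨Nat.find h, (Nat.find_spec h).1.le, fun j => ⟨fun hj => ?_, fun hj => ?_⟩⟩
    · by_contra hlt
      obtain ⟨h1, h2⟩ := Nat.find_spec h
      rcases (not_lt.1 hlt).lt_or_eq with h3 | h3
      · exact h2 (hS ⟨_, h1⟩ j h3 hj)
      · exact h2 (by convert hj)
    · have := Nat.find_min h hj
      push Not at this
      exact this j.isLt
  · push Not at h
    exact ⟨a, le_rfl, fun j => ⟨fun _ => j.isLt, fun _ => h j j.isLt⟩⟩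

open Classical in
/-- The number of entries in each row of a filling which satisfy `p`. -/
def rowCount {k : ℕ} {α : Fin k → ℕ} {L : Type*} (p : L → Prop) (T : Cell α → L) (i : Fin k) : ℕ :=
  (Finset.univ.filter fun j : Fin (α i) => p (T ⟨i, j⟩)).card

lemma rowCount_eq {k : ℕ} {α : Fin k → ℕ} {L : Type*} {p : L → Prop} {T : Cell α → L} {i : Fin k}
    {m : ℕ} (hm : m ≤ α i) (h : ∀ j : Fin (α i), p (T ⟨i, j⟩) ↔ (j : ℕ) < m) :
    rowCount p T i = m := by
  classical
  simp only [rowCount, h]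
  rw [Fin.card_filter_val_lt]
  omega

lemma rowCount_spec {k : ℕ} {α : Fin k → ℕ} {L : Type*} {p : L → Prop} {T : Cell α → L}
    (hp : ∀ c d : Cell α, c.1 = d.1 → (c.2 : ℕ) < d.2 → p (T d) → p (T c)) :
    (∀ i, rowCount p T i ≤ α i) ∧ ∀ c, p (T c) ↔ (c.2 : ℕ) < rowCount p T c.1 := by
  have key : ∀ i, ∃ m ≤ α i, ∀ j : Fin (α i), p (T ⟨i, j⟩) ↔ (j : ℕ) < m := fun i =>
    exists_threshold (fun j => p (T ⟨i, j⟩)) fun j j' hj => hp ⟨i, j⟩ ⟨i, j'⟩ rfl hj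
  refine ⟨fun i => ?_, fun ⟨i, j⟩ => ?_⟩
  · obtain ⟨m, h1, h2⟩ := key i
    rwa [rowCount_eq h1 h2]
  · obtain ⟨m, h1, h2⟩ := key i
    rw [rowCount_eq h1 h2, h2]

lemma prod_threshold {a m b : ℕ} (x y : R) (hm : m ≤ b) (hb : b ≤ a) :
    ∏ j : Fin a, (if (j : ℕ) < m then 1 else if (j : ℕ) < b then x else y) =
      x ^ (b - m) * y ^ (a - b) := by
  rw [Fin.prod_univ_eq_prod_range (fun j => if j < m then 1 else if j < b then x else y) a,
    Finset.range_eq_Ico, ← Finset.prod_Ico_consecutive _ (Nat.zero_le m) (hm.trans hb),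
    ← Finset.prod_Ico_consecutive _ hm hb, Finset.prod_eq_one, one_mul]
  · congr 1
    · rw [Finset.prod_congr rfl (g := fun _ => x)]
      · simp
      · intro j hj
        rw [Finset.mem_Ico] at hj
        rw [if_neg (by omega), if_pos (by omega)]
    · rw [Finset.prod_congr rfl (g := fun _ => y)]
      · simp
      · intro j hj
        rw [Finset.mem_Ico] at hj
        rw [if_neg (by omega), if_neg (by omega)]
  · intro j hj
    rw [Finset.mem_Ico] at hj
    rw [if_pos (by omega)]

lemma spEmbed_injective {n : ℕ} : Function.Injective (spEmbed (n := n)) := fun a b h =>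
  spRank_injective (by rw [← spRank_spEmbed a, h, spRank_spEmbed])

lemma IsSpTableau.iff_spRank {k n : ℕ} {α : Fin k → ℕ} {T : Cell α → SpLetter n} :
    IsSpTableau α T ↔
      (∀ c d : Cell α, c.1 = d.1 → (c.2 : ℕ) < d.2 → spRank (T c) ≤ spRank (T d)) ∧
      (∀ c d : Cell α, (c.2 : ℕ) = d.2 → c.1 < d.1 → spRank (T c) < spRank (T d)) ∧
      ∀ c : Cell α, 2 * (c.1 : ℕ) ≤ spRank (T c) := by
  have e : ∀ (c : Cell α), (c.1 : ℕ) ≤ (ofLex (T c)).1 ↔ 2 * (c.1 : ℕ) ≤ spRank (T c) := by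
    intro c
    have := spRank_div_two (T c)
    omega
  simp only [spRank_le_iff, spRank_lt_iff, ← e]
  exact ⟨fun h => ⟨h.row_weak, h.col_strict, h.row_bound⟩, fun h => ⟨h.1, h.2.1, h.2.2⟩⟩

/-- The letters `n + 1` and its barred version, placed according to the shape `ν`. -/
def lastFiller {n : ℕ} {α : Fin (n + 1) → ℕ} (ν : Fin (n + 1) → ℕ) (c : Cell α) : SpLetter (n + 1) :=
  toLex (Fin.last n, decide (ν c.1 ≤ c.2))

lemma spRank_lastFiller {n : ℕ} {α : Fin (n + 1) → ℕ} (ν : Fin (n + 1) → ℕ) (c : Cell α) :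
    spRank (lastFiller ν c) = if (c.2 : ℕ) < ν c.1 then 2 * n else 2 * n + 1 := by
  by_cases h : (c.2 : ℕ) < ν c.1
  · simp [spRank, lastFiller, h]
  · simp [spRank, lastFiller, h, not_lt.1 h]

/-- The cells with the letters preceding the last pair, respectively the last letter, have the
shapes `μ` and `ν`. -/
structure HasProfile {n : ℕ} {α : Fin (n + 1) → ℕ} (ν : Fin (n + 1) → ℕ) (μ : Fin n → ℕ)
    (T : Cell α → SpLetter (n + 1)) : Prop where
  upper : ∀ c, spRank (T c) < 2 * n + 1 ↔ (c.2 : ℕ) < ν c.1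
  lower : ∀ c, spRank (T c) < 2 * n ↔ ∃ i : Fin n, i.castSucc = c.1 ∧ (c.2 : ℕ) < μ i

/-- Interlacing is what makes the added letters column strict: each column receives each of the two
new letters at most once. -/
lemma isSpTableau_extend {n : ℕ} {α ν : Fin (n + 1) → ℕ} {μ : Fin n → ℕ} (hν : ν ∈ upperStrip α)
    (hμ : μ ∈ lowerStrip ν) (h : ∀ i : Fin n, μ i ≤ α i.castSucc) {T : Cell μ → SpLetter n}
    (hT : IsSpTableau μ T) :
    IsSpTableau α (extendFilling (cellInc Fin.castSucc h) spEmbed (lastFiller ν) T) ∧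
      HasProfile ν μ (extendFilling (cellInc Fin.castSucc h) spEmbed (lastFiller ν) T) := by
  have hinj := cellInc_injective (Fin.castSucc_injective n) h
  set T' := extendFilling (cellInc Fin.castSucc h) spEmbed (lastFiller ν) T with hT'
  have hanti := antitone_of_mem_upperStrip hν
  have hantiμ := antitone_of_mem_lowerStrip hμ
  rw [mem_upperStrip] at hν
  rw [mem_lowerStrip] at hμ
  have h1 : ∀ d, spRank (T' (cellInc Fin.castSucc h d)) = spRank (T d) := fun d => by
    rw [hT', extendFilling_apply hinj, spRank_spEmbed]
  have h2 : ∀ c, (¬ ∃ d, cellInc Fin.castSucc h d = c) →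
      spRank (T' c) = if (c.2 : ℕ) < ν c.1 then 2 * n else 2 * n + 1 := fun c hc => by
    rw [hT', extendFilling_of_not _ _ _ hc, spRank_lastFiller]
  rw [IsSpTableau.iff_spRank] at hT ⊢
  obtain ⟨hr, hc, hb⟩ := hT
  have hout : ∀ c : Cell α, (¬ ∃ d, cellInc Fin.castSucc h d = c) → 2 * n ≤ spRank (T' c) := by
    intro c hc
    rw [h2 c hc]
    split_ifs <;> omega
  refine ⟨⟨?_, ?_, ?_⟩, ⟨?_, ?_⟩⟩
  · intro c d hcd hlt
    by_cases hd : ∃ d', cellInc Fin.castSucc h d' = d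
    · have hd2 := hd
      rw [exists_cellInc] at hd2
      obtain ⟨i, hi, hlt'⟩ := hd2
      have hc : ∃ c', cellInc Fin.castSucc h c' = c :=
        (exists_cellInc h c).2 ⟨i, hi.trans hcd.symm, hlt.trans hlt'⟩
      obtain ⟨d, rfl⟩ := hd
      obtain ⟨c, rfl⟩ := hc
      rw [h1, h1]
      exact hr c d (Fin.castSucc_injective n hcd) hlt
    · by_cases hc : ∃ c', cellInc Fin.castSucc h c' = c
      · obtain ⟨c, rfl⟩ := hc
        rw [h1]
        exact (spRank_lt _).le.trans (hout d hd)
      · have hνcd : ν c.1 = ν d.1 := congrArg ν hcd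
        rw [h2 c hc, h2 d hd, hνcd]
        split_ifs <;> omega
  · intro c d hcd hlt
    by_cases hd : ∃ d', cellInc Fin.castSucc h d' = d
    · have hd2 := hd
      rw [exists_cellInc] at hd2
      obtain ⟨i, hi, hlt'⟩ := hd2
      have hlt2 : (c.1 : ℕ) < i := by rw [← hi] at hlt; exact hlt
      have hc : ∃ c', cellInc Fin.castSucc h c' = c := by
        refine (exists_cellInc h c).2 ⟨⟨c.1, hlt2.trans i.isLt⟩, rfl, ?_⟩
        rw [hcd]
        exact hlt'.trans_le (hantiμ hlt2.le)
      obtain ⟨d, rfl⟩ := hd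
      obtain ⟨c, rfl⟩ := hc
      rw [h1, h1]
      exact hc c d hcd hlt
    · by_cases hc : ∃ c', cellInc Fin.castSucc h c' = c
      · obtain ⟨c, rfl⟩ := hc
        rw [h1]
        exact (spRank_lt _).trans_le (hout d hd)
      · have hlt3 : (c.1 : ℕ) < d.1 := hlt
        have hcn : (c.1 : ℕ) < n := by have := d.1.isLt; omega
        obtain ⟨i, hi⟩ : ∃ i : Fin n, i.castSucc = c.1 := ⟨⟨c.1, hcn⟩, rfl⟩
        have hi' : (c.1 : ℕ) = i := by rw [← hi]; rfl
        -- Two added cells in one column: the upper lies inside `ν` because `α (i + 1) ≤ ν i`, and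
        -- the lower lies outside because `ν (i + 1) ≤ μ i`.
        have hsucc : i.succ ≤ d.1 := by rw [Fin.le_def, Fin.val_succ]; omega
        have hd3 : (d.2 : ℕ) < ν c.1 := by
          rw [← hi]
          have hα : α d.1 ≤ α i.succ := by
            rcases hsucc.eq_or_lt with h5 | h5
            · rw [h5]
            · obtain ⟨k, hk⟩ : ∃ k : Fin n, k.succ = d.1 :=
                ⟨⟨d.1 - 1, by have := d.1.isLt; omega⟩, Fin.ext (by simp; omega)⟩
              rw [← hk]
              refine (hν.2 k).trans ((hanti ?_).trans (hν.1 _))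
              rw [Fin.le_def, Fin.val_succ, Fin.val_castSucc]
              have : (d.1 : ℕ) = k + 1 := by rw [← hk]; rfl
              rw [Fin.lt_def, Fin.val_succ] at h5
              omega
          exact d.2.isLt.trans_le (hα.trans (hν.2 i))
        have hd4 : ν d.1 ≤ d.2 := by
          rw [exists_cellInc] at hc
          have : μ i ≤ c.2 := by
            by_contra h6
            exact hc ⟨i, hi, not_le.1 h6⟩
          rw [← hcd]
          exact ((hanti hsucc).trans (hμ i).1).trans this
        rw [h2 c hc, h2 d hd, if_pos (by omega), if_neg (by omega)]
        omega
  · intro c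
    by_cases hc : ∃ c', cellInc Fin.castSucc h c' = c
    · obtain ⟨c, rfl⟩ := hc
      rw [h1]
      exact hb c
    · have := hout c hc
      have := c.1.isLt
      omega
  · intro c
    by_cases hc : ∃ c', cellInc Fin.castSucc h c' = c
    · have hc2 := hc
      rw [exists_cellInc] at hc2
      obtain ⟨i, hi, hlt⟩ := hc2
      obtain ⟨c, rfl⟩ := hc
      rw [h1]
      have := spRank_lt (T c)
      have := (hμ i).2
      rw [hi] at this
      constructor <;> intro _ <;> omega
    · rw [h2 c hc]
      split_ifs with h5 <;> simp [h5]
  · intro c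
    rw [← exists_cellInc h]
    by_cases hc : ∃ c', cellInc Fin.castSucc h c' = c
    · simp only [hc, iff_true]
      obtain ⟨c, rfl⟩ := hc
      rw [h1]
      exact spRank_lt _
    · simp only [hc, iff_false, not_lt]
      exact hout c hc

lemma exists_restrict {n : ℕ} {α ν : Fin (n + 1) → ℕ} {μ : Fin n → ℕ}
    (h : ∀ i : Fin n, μ i ≤ α i.castSucc) {T : Cell α → SpLetter (n + 1)}
    (hT : IsSpTableau α T) (hp : HasProfile ν μ T) :
    ∃ T' : Cell μ → SpLetter n, IsSpTableau μ T' ∧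
      extendFilling (cellInc Fin.castSucc h) spEmbed (lastFiller ν) T' = T := by
  have hinj := cellInc_injective (Fin.castSucc_injective n) h
  have key : ∀ d : Cell μ, ∃ b : SpLetter n, spEmbed b = T (cellInc Fin.castSucc h d) := fun d =>
    exists_spEmbed _ ((hp.lower _).2 ((exists_cellInc h _).1 ⟨d, rfl⟩))
  choose T' hT' using key
  refine ⟨T', ?_, ?_⟩
  · rw [IsSpTableau.iff_spRank] at hT ⊢
    simp only [← spRank_spEmbed (T' _), hT']
    refine ⟨fun c d hcd hlt => hT.1 _ _ ?_ hlt, fun c d hcd hlt => hT.2.1 _ _ hcd ?_,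
      fun c => hT.2.2 (cellInc Fin.castSucc h c)⟩
    · exact congrArg Fin.castSucc hcd
    · exact hlt
  · funext c
    by_cases hc : ∃ d, cellInc Fin.castSucc h d = c
    · obtain ⟨d, rfl⟩ := hc
      rw [extendFilling_apply hinj, hT']
    · rw [extendFilling_of_not _ _ _ hc]
      apply spRank_injective
      rw [spRank_lastFiller]
      have h1 := hp.upper c
      have h2 := hp.lower c
      rw [← exists_cellInc h] at h2
      simp only [hc, iff_false, not_lt] at h2
      have h3 := spRank_lt (T c)
      split_ifs with h4
      · have := h1.2 h4; omega
      · have : ¬ spRank (T c) < 2 * n + 1 := fun h5 => h4 (h1.1 h5)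
        omega

/-- The inequalities between adjacent rows are column strictness: a failure would put two strictly
increasing letters of one column into a range with room for only one. -/
lemma exists_profile {n : ℕ} {α : Fin (n + 1) → ℕ} {T : Cell α → SpLetter (n + 1)}
    (hα : Antitone α) (hT : IsSpTableau α T) :
    rowCount (fun a => spRank a < 2 * n + 1) T ∈ upperStrip α ∧
      (fun i : Fin n => rowCount (fun a => spRank a < 2 * n) T i.castSucc) ∈
        lowerStrip (rowCount (fun a => spRank a < 2 * n + 1) T) ∧
      HasProfile (rowCount (fun a => spRank a < 2 * n + 1) T)
        (fun i => rowCount (fun a => spRank a < 2 * n) T i.castSucc) T := by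
  rw [IsSpTableau.iff_spRank] at hT
  obtain ⟨hr, hc, hb⟩ := hT
  obtain ⟨u1, u2⟩ := rowCount_spec (p := fun a => spRank a < 2 * n + 1) (T := T)
    fun c d h1 h2 h3 => (hr c d h1 h2).trans_lt h3
  obtain ⟨l1, l2⟩ := rowCount_spec (p := fun a => spRank a < 2 * n) (T := T)
    fun c d h1 h2 h3 => (hr c d h1 h2).trans_lt h3
  set ν := rowCount (fun a => spRank a < 2 * n + 1) T
  set κ := rowCount (fun a => spRank a < 2 * n) T
  refine ⟨mem_upperStrip.2 ⟨u1, fun j => ?_⟩, mem_lowerStrip.2 fun j => ⟨?_, ?_⟩, ⟨u2, fun c => ?_⟩⟩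
  · by_contra hlt
    push Not at hlt
    have hle : α j.succ ≤ α j.castSucc := hα (Fin.castSucc_lt_succ (i := j)).le
    have h1 := hc ⟨j.castSucc, ⟨ν j.castSucc, hlt.trans_le hle⟩⟩ ⟨j.succ, ⟨ν j.castSucc, hlt⟩⟩ rfl
      Fin.castSucc_lt_succ
    have h2 := u2 ⟨j.castSucc, ⟨ν j.castSucc, hlt.trans_le hle⟩⟩
    have h3 := spRank_lt (T ⟨j.succ, ⟨ν j.castSucc, hlt⟩⟩)
    simp only [lt_irrefl, iff_false] at h2
    omega
  · by_contra hlt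
    push Not at hlt
    have hle : α j.succ ≤ α j.castSucc := hα (Fin.castSucc_lt_succ (i := j)).le
    have hlt' := hlt.trans_le (u1 _)
    have h1 := hc ⟨j.castSucc, ⟨κ j.castSucc, hlt'.trans_le hle⟩⟩ ⟨j.succ, ⟨κ j.castSucc, hlt'⟩⟩ rfl
      Fin.castSucc_lt_succ
    have h2 := l2 ⟨j.castSucc, ⟨κ j.castSucc, hlt'.trans_le hle⟩⟩
    have h3 := (u2 ⟨j.succ, ⟨κ j.castSucc, hlt'⟩⟩).2 hlt
    simp only [lt_irrefl, iff_false] at h2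
    omega
  · by_contra hlt
    push Not at hlt
    have hlt' := hlt.trans_le (l1 _)
    have h2 := (l2 ⟨j.castSucc, ⟨ν j.castSucc, hlt'⟩⟩).2 hlt
    have h3 := (u2 ⟨j.castSucc, ⟨ν j.castSucc, hlt'⟩⟩)
    simp only [lt_irrefl, iff_false] at h3
    omega
  · rw [l2]
    constructor
    · intro h
      have h1 := (l2 c).2 h
      have h2 := hb c
      -- The row bound excludes the smaller letters from the last row, which is why `μ` has one row
      -- fewer.
      obtain ⟨i, hi⟩ : ∃ i : Fin n, i.castSucc = c.1 := ⟨⟨c.1, by omega⟩, rfl⟩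
      exact ⟨i, hi, by rwa [hi]⟩
    · rintro ⟨i, hi, hlt⟩
      exact hlt.trans_eq (congrArg κ hi)

lemma HasProfile.eq {n : ℕ} {α ν : Fin (n + 1) → ℕ} {μ : Fin n → ℕ}
    {T : Cell α → SpLetter (n + 1)} (hν : ∀ i, ν i ≤ α i) (hμ : ∀ i : Fin n, μ i ≤ α i.castSucc)
    (hp : HasProfile ν μ T) :
    rowCount (fun a => spRank a < 2 * n + 1) T = ν ∧
      (fun i : Fin n => rowCount (fun a => spRank a < 2 * n) T i.castSucc) = μ := by
  constructor
  · funext i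
    exact rowCount_eq (hν i) fun j => hp.upper ⟨i, j⟩
  · funext i
    refine rowCount_eq (hμ i) fun j => (hp.lower ⟨i.castSucc, j⟩).trans ⟨?_, fun h => ⟨i, rfl, h⟩⟩
    rintro ⟨i', hi', h⟩
    obtain rfl := Fin.castSucc_injective n hi'
    exact h

open Classical in
lemma lastFiller_weight {n : ℕ} {α ν : Fin (n + 1) → ℕ} {μ : Fin n → ℕ} (hν : ν ∈ upperStrip α)
    (hμ : μ ∈ lowerStrip ν) (h : ∀ i : Fin n, μ i ≤ α i.castSucc) (x : Fin (n + 1) → Rˣ) :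
    (∏ c : Cell α, if ∃ d, cellInc Fin.castSucc h d = c then 1 else spWeight x (lastFiller ν c)) =
      branchWeight ((x (Fin.last n) : Rˣ) : R) (((x (Fin.last n))⁻¹ : Rˣ) : R) 0 α ν μ := by
  rw [mem_upperStrip] at hν
  rw [mem_lowerStrip] at hμ
  set X := ((x (Fin.last n) : Rˣ) : R)
  set Y := (((x (Fin.last n))⁻¹ : Rˣ) : R)
  have hXY : X * Y = 1 := Units.mul_inv _
  have e : ∀ k, X ^ k * Y ^ k = 1 := fun k => by rw [← mul_pow, hXY, one_pow]
  have hw : ∀ c : Cell α, spWeight x (lastFiller ν c) = if (c.2 : ℕ) < ν c.1 then X else Y := by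
    intro c
    by_cases h1 : (c.2 : ℕ) < ν c.1
    · have h2 : decide (ν c.1 ≤ c.2) = false := decide_eq_false (not_le.2 h1)
      simp only [spWeight, lastFiller, h2, if_pos h1]
      rfl
    · simp [spWeight, lastFiller, h1, not_lt.1 h1, Y]
  -- Because `Y` inverts `X`, the truncated differences can be replaced by a product over `α`, `ν`
  -- and `μ` separately.
  have hrow : ∀ (i : Fin (n + 1)) (m : ℕ), m ≤ ν i → X ^ (ν i - m) * Y ^ (α i - ν i) =
      X ^ (2 * ν i) * Y ^ α i * Y ^ m := by
    intro i m hm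
    obtain ⟨p, hp⟩ := Nat.exists_eq_add_of_le hm
    obtain ⟨q, hq⟩ := Nat.exists_eq_add_of_le (hν.1 i)
    rw [hq, hp, Nat.add_sub_cancel_left, Nat.add_sub_cancel_left]
    have e1 := e (2 * m)
    have e2 := e p
    have : X ^ (2 * (m + p)) * Y ^ (m + p + q) * Y ^ m =
      (X ^ (2 * m) * Y ^ (2 * m)) * (X ^ p * Y ^ p) * (X ^ p * Y ^ q) := by ring
    rw [this, e1, e2]; ring
  simp only [hw, exists_cellInc]
  rw [Fintype.prod_sigma, Fin.prod_univ_castSucc]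
  have h1 : ∀ i : Fin n, (∏ j : Fin (α i.castSucc),
      if ∃ i', Fin.castSucc i' = i.castSucc ∧ (j : ℕ) < μ i' then 1
        else if (j : ℕ) < ν i.castSucc then X else Y) =
      X ^ (2 * ν i.castSucc) * Y ^ α i.castSucc * Y ^ μ i := by
    intro i
    rw [← hrow _ _ (hμ i).2, ← prod_threshold X Y (hμ i).2 (hν.1 _)]
    refine Finset.prod_congr rfl fun j _ => ?_
    congr 1
    simp
  have h2 : (∏ j : Fin (α (Fin.last n)),
      if ∃ i', Fin.castSucc i' = Fin.last n ∧ (j : ℕ) < μ i' then 1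
        else if (j : ℕ) < ν (Fin.last n) then X else Y) =
      X ^ (2 * ν (Fin.last n)) * Y ^ α (Fin.last n) := by
    have := hrow (Fin.last n) 0 (Nat.zero_le _)
    rw [pow_zero, mul_one] at this
    rw [← this, ← prod_threshold X Y (Nat.zero_le _) (hν.1 _)]
    refine Finset.prod_congr rfl fun j _ => ?_
    congr 1
    simp [Fin.castSucc_ne_last]
  rw [Finset.prod_congr rfl fun i _ => h1 i, h2, branchWeight]
  simp only [zero_mul, add_zero, ite_self, mul_one]
  rw [Fin.prod_univ_castSucc, Finset.prod_mul_distrib]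
  ring

/-- Branching of the symplectic Schur functions in the last variable. -/
theorem sp_branch {n : ℕ} (α : Fin (n + 1) → ℕ) (hα : Antitone α) (x : Fin (n + 1) → Rˣ) :
    sp α x = ∑ ν ∈ upperStrip α, ∑ μ ∈ lowerStrip ν,
      branchWeight ((x (Fin.last n) : Rˣ) : R) (((x (Fin.last n))⁻¹ : Rˣ) : R) 0 α ν μ *
        sp μ (fun i => x i.castSucc) := by
  classical
  rw [sp, ← Finset.sum_fiberwise_of_maps_to
    (g := rowCount fun a : SpLetter (n + 1) => spRank a < 2 * n + 1) (t := upperStrip α)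
    fun T hT => (exists_profile hα (Finset.mem_filter.1 hT).2).1]
  refine Finset.sum_congr rfl fun ν hν => ?_
  rw [← Finset.sum_fiberwise_of_maps_to
    (g := fun T (i : Fin n) => rowCount (fun a : SpLetter (n + 1) => spRank a < 2 * n) T i.castSucc)
    (t := lowerStrip ν)]
  swap
  · intro T hT
    rw [Finset.mem_filter, Finset.mem_filter] at hT
    rw [← hT.2]
    exact (exists_profile hα hT.1.2).2.1
  refine Finset.sum_congr rfl fun μ hμ => ?_
  have hν1 := (mem_upperStrip.1 hν).1
  have h : ∀ i : Fin n, μ i ≤ α i.castSucc := fun i => ((mem_lowerStrip.1 hμ i).2).trans (hν1 _)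
  rw [← lastFiller_weight hν hμ h x, sp]
  simp only [← spWeight_spEmbed x]
  rw [← sum_extendFilling (cellInc_injective (Fin.castSucc_injective n) h) spEmbed_injective
    (lastFiller ν) (spWeight x) (fun T => IsSpTableau α T ∧ HasProfile ν μ T) (IsSpTableau μ)
    (fun T hT => isSpTableau_extend hν hμ h hT) (fun T hT => exists_restrict h hT.1 hT.2)]
  refine Finset.sum_congr (Finset.ext fun T => ?_) fun _ _ => rfl
  simp only [Finset.mem_filter, Finset.mem_univ, true_and]
  constructor
  · rintro ⟨⟨h1, rfl⟩, rfl⟩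
    exact ⟨h1, (exists_profile hα h1).2.2⟩
  · rintro ⟨h1, h2⟩
    obtain ⟨h3, h4⟩ := h2.eq hν1 h
    exact ⟨⟨h1, h3⟩, h4⟩

/-! ### Removing the primed letter: vertical strips. -/

/-- The position of a letter in the alphabet `1 < 1̄ < ⋯ < n < n̄ < 1'`, counted from `0`. -/
def spoRank {n : ℕ} (a : SpoLetter n 1) : ℕ := Sum.elim spRank (fun _ => 2 * n) (ofLex a)

/-- The inclusion of the unprimed letters. -/
def spoEmbed {n : ℕ} (a : SpLetter n) : SpoLetter n 1 := toLex (Sum.inl a)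

/-- The letter `1'`. -/
def primed {n : ℕ} : SpoLetter n 1 := toLex (Sum.inr 0)

lemma spoEmbed_injective {n : ℕ} : Function.Injective (spoEmbed (n := n)) := fun a b h => by
  simpa [spoEmbed] using h

lemma spoRank_spoEmbed {n : ℕ} (a : SpLetter n) : spoRank (spoEmbed a) = spRank a := rfl

lemma spoRank_primed {n : ℕ} : spoRank (primed (n := n)) = 2 * n := rfl

lemma spoLetter_cases {n : ℕ} (a : SpoLetter n 1) : (∃ b, a = spoEmbed b) ∨ a = primed := by
  rcases h : ofLex a with b | b
  · exact Or.inl ⟨b, ofLex.injective h⟩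
  · refine Or.inr (ofLex.injective ?_)
    rw [h, Subsingleton.elim b 0]
    rfl

lemma spoRank_le_iff {n : ℕ} {a b : SpoLetter n 1} : spoRank a ≤ spoRank b ↔ a ≤ b := by
  rcases spoLetter_cases a with ⟨a, rfl⟩ | rfl <;> rcases spoLetter_cases b with ⟨b, rfl⟩ | rfl
  · rw [spoRank_spoEmbed, spoRank_spoEmbed, spRank_le_iff]
    exact Sum.Lex.inl_le_inl_iff.symm
  · exact iff_of_true (spRank_lt a).le (Sum.Lex.inl_le_inr _ _)
  · exact iff_of_false (not_le.2 (spRank_lt b)) Sum.Lex.not_inr_le_inl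
  · simp

lemma spoWeight_spoEmbed {n : ℕ} (x : Fin n → Rˣ) (y : Fin 1 → R) (a : SpLetter n) :
    spoWeight x y (spoEmbed a) = spWeight x a := rfl

lemma ofLex_eq_inl_iff {n : ℕ} {a : SpoLetter n 1} {b : SpLetter n} :
    ofLex a = Sum.inl b ↔ a = spoEmbed b := Iff.rfl

lemma ofLex_eq_inr_iff {n : ℕ} {a : SpoLetter n 1} {b : Fin 1} :
    ofLex a = Sum.inr b ↔ a = primed := by
  rw [Subsingleton.elim b 0]; exact Iff.rfl

lemma IsSpoTableau.iff_spoRank {k n : ℕ} {α : Fin k → ℕ} {T : Cell α → SpoLetter n 1} :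
    IsSpoTableau α T ↔
      (∀ c d : Cell α, c.1 = d.1 → (c.2 : ℕ) < d.2 →
        spoRank (T c) ≤ spoRank (T d) ∧ spoRank (T c) < 2 * n) ∧
      (∀ c d : Cell α, (c.2 : ℕ) = d.2 → c.1 < d.1 → spoRank (T c) ≤ spoRank (T d) ∧
        (spoRank (T d) < 2 * n → spoRank (T c) < spoRank (T d))) ∧
      ∀ c : Cell α, spoRank (T c) < 2 * n → 2 * (c.1 : ℕ) ≤ spoRank (T c) := by
  constructor
  · intro h
    refine ⟨fun c d h1 h2 => ⟨spoRank_le_iff.2 (h.row_weak c d h1 h2), ?_⟩,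
      fun c d h1 h2 => ⟨spoRank_le_iff.2 (h.col_weak c d h1 h2), fun h3 => ?_⟩, fun c h3 => ?_⟩
    · rcases spoLetter_cases (T c) with ⟨a, ha⟩ | ha
      · rw [ha]; exact spRank_lt a
      · have hd := h.row_weak c d h1 h2
        rcases spoLetter_cases (T d) with ⟨b, hb⟩ | hb
        · rw [ha, hb, ← spoRank_le_iff] at hd
          exact absurd hd (not_le.2 (spRank_lt b))
        · exact absurd (h.row_strict c d 0 0 h1 h2 (ofLex_eq_inr_iff.2 ha) (ofLex_eq_inr_iff.2 hb))
            (lt_irrefl _)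
    · have hle := h.col_weak c d h1 h2
      rcases spoLetter_cases (T d) with ⟨b, hb⟩ | hb
      · rcases spoLetter_cases (T c) with ⟨a, ha⟩ | ha
        · rw [ha, hb]
          exact spRank_lt_iff.2 (h.col_strict c d a b h1 h2 ha hb)
        · rw [ha, hb, ← spoRank_le_iff] at hle
          exact absurd hle (not_le.2 (spRank_lt b))
      · rw [hb, spoRank_primed] at h3
        omega
    · rcases spoLetter_cases (T c) with ⟨a, ha⟩ | ha
      · have h4 := h.row_bound c a ha
        have h5 := spRank_div_two a
        rw [ha, spoRank_spoEmbed]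
        omega
      · rw [ha, spoRank_primed] at h3
        omega
  · rintro ⟨hr, hc, hb⟩
    refine ⟨fun c d h1 h2 => spoRank_le_iff.1 (hr c d h1 h2).1,
      fun c d h1 h2 => spoRank_le_iff.1 (hc c d h1 h2).1, ?_, ?_, ?_⟩
    · intro c d a b h1 h2 ha hb'
      have h3 := (hc c d h1 h2).2
      rw [ofLex_eq_inl_iff.1 ha, ofLex_eq_inl_iff.1 hb'] at h3
      exact spRank_lt_iff.1 (h3 (spRank_lt b))
    · intro c a ha
      have h3 := hb c
      rw [ofLex_eq_inl_iff.1 ha, spoRank_spoEmbed] at h3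
      have h4 := h3 (spRank_lt a)
      have h5 := spRank_div_two a
      omega
    · intro c d a b h1 h2 ha hb'
      have h3 := (hr c d h1 h2).2
      rw [ofLex_eq_inr_iff.1 ha, spoRank_primed] at h3
      exact absurd h3 (lt_irrefl _)

open Classical in
/-- The partitions `μ` such that `α / μ` is a vertical strip. -/
def vertStrip {k : ℕ} (α : Fin k → ℕ) : Finset (Fin k → ℕ) :=
  {μ ∈ Fintype.piFinset fun i => Finset.Icc (α i - 1) (α i) | Antitone μ}

lemma mem_vertStrip {k : ℕ} {α μ : Fin k → ℕ} :
    μ ∈ vertStrip α ↔ (∀ i, α i - 1 ≤ μ i ∧ μ i ≤ α i) ∧ Antitone μ := by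
  simp [vertStrip]

lemma isSpoTableau_extend {k n : ℕ} {α μ : Fin k → ℕ} (hμ : μ ∈ vertStrip α)
    (h : ∀ i, μ i ≤ α (id i)) {T : Cell μ → SpLetter n} (hT : IsSpTableau μ T) :
    IsSpoTableau α (extendFilling (cellInc id h) spoEmbed (fun _ => primed) T) ∧
      ∀ c, spoRank (extendFilling (cellInc id h) spoEmbed (fun _ => primed) T c) < 2 * n ↔
        (c.2 : ℕ) < μ c.1 := by
  have hinj := cellInc_injective Function.injective_id h
  set T' := extendFilling (cellInc id h) spoEmbed (fun _ => primed) T with hT'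
  rw [mem_vertStrip] at hμ
  obtain ⟨hμ, hanti⟩ := hμ
  have h1 : ∀ d, spoRank (T' (cellInc id h d)) = spRank (T d) := fun d => by
    rw [hT', extendFilling_apply hinj, spoRank_spoEmbed]
  have h2 : ∀ c, (¬ ∃ d, cellInc id h d = c) → spoRank (T' c) = 2 * n := fun c hc => by
    rw [hT', extendFilling_of_not _ _ _ hc, spoRank_primed]
  have hex : ∀ c : Cell α, (∃ d, cellInc id h d = c) ↔ (c.2 : ℕ) < μ c.1 := fun c => by
    rw [exists_cellInc]
    constructor
    · rintro ⟨i, hi, hlt⟩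
      exact hlt.trans_eq (congrArg μ hi)
    · exact fun hlt => ⟨c.1, rfl, hlt⟩
  rw [IsSpTableau.iff_spRank] at hT
  rw [IsSpoTableau.iff_spoRank]
  obtain ⟨hr, hc, hb⟩ := hT
  have hle : ∀ c, spoRank (T' c) ≤ 2 * n := by
    intro c
    by_cases hc : ∃ d, cellInc id h d = c
    · obtain ⟨c, rfl⟩ := hc
      rw [h1]
      exact (spRank_lt _).le
    · exact (h2 c hc).le
  have hprof : ∀ c, spoRank (T' c) < 2 * n ↔ (c.2 : ℕ) < μ c.1 := by
    intro c
    rw [← hex]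
    by_cases hc : ∃ d, cellInc id h d = c
    · simp only [hc, iff_true]
      obtain ⟨c, rfl⟩ := hc
      rw [h1]
      exact spRank_lt _
    · simp only [hc, iff_false, not_lt]
      exact (h2 c hc).ge
  refine ⟨⟨?_, ?_, ?_⟩, hprof⟩
  · intro c d hcd hlt
    have hlt3 : (c.2 : ℕ) < μ c.1 := by
      have h3 := (hμ d.1).1
      have h4 := d.2.isLt
      have h5 : μ c.1 = μ d.1 := congrArg μ hcd
      omega
    refine ⟨?_, (hprof c).2 hlt3⟩
    by_cases hd : ∃ d', cellInc id h d' = d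
    · obtain ⟨d, rfl⟩ := hd
      obtain ⟨c, rfl⟩ := (hex c).2 hlt3
      rw [h1, h1]
      exact hr c d hcd hlt
    · rw [h2 d hd]
      exact hle c
  · intro c d hcd hlt
    by_cases hd : ∃ d', cellInc id h d' = d
    · have hc' : ∃ d', cellInc id h d' = c := by
        rw [hex] at hd ⊢
        rw [hcd]
        exact hd.trans_le (hanti hlt.le)
      obtain ⟨d, rfl⟩ := hd
      obtain ⟨c, rfl⟩ := hc'
      rw [h1, h1]
      have := hc c d hcd hlt
      exact ⟨this.le, fun _ => this⟩
    · rw [h2 d hd]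
      exact ⟨hle c, fun h => absurd h (lt_irrefl _)⟩
  · intro c hlt
    obtain ⟨c, rfl⟩ := (hex c).2 ((hprof c).1 hlt)
    rw [h1]
    exact hb c

lemma exists_restrict_spo {k n : ℕ} {α μ : Fin k → ℕ} (h : ∀ i, μ i ≤ α (id i))
    {T : Cell α → SpoLetter n 1} (hT : IsSpoTableau α T)
    (hp : ∀ c, spoRank (T c) < 2 * n ↔ (c.2 : ℕ) < μ c.1) :
    ∃ T' : Cell μ → SpLetter n, IsSpTableau μ T' ∧
      extendFilling (cellInc id h) spoEmbed (fun _ => primed) T' = T := by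
  have hinj := cellInc_injective Function.injective_id h
  have hlt : ∀ d : Cell μ, spoRank (T (cellInc id h d)) < 2 * n := fun d => (hp _).2 d.2.isLt
  have key : ∀ d : Cell μ, ∃ b : SpLetter n, T (cellInc id h d) = spoEmbed b := fun d => by
    rcases spoLetter_cases (T (cellInc id h d)) with h1 | h1
    · exact h1
    · have := hlt d
      rw [h1, spoRank_primed] at this
      omega
  choose T' hT' using key
  refine ⟨T', ?_, ?_⟩
  · rw [IsSpoTableau.iff_spoRank] at hT
    rw [IsSpTableau.iff_spRank]
    simp only [← spoRank_spoEmbed, ← hT']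
    exact ⟨fun c d hcd h1 => (hT.1 _ (cellInc id h d) hcd h1).1,
      fun c d hcd h1 => (hT.2.1 _ (cellInc id h d) hcd h1).2 (hlt d),
      fun c => hT.2.2 (cellInc id h c) (hlt c)⟩
  · funext c
    by_cases hc : ∃ d, cellInc id h d = c
    · obtain ⟨d, rfl⟩ := hc
      rw [extendFilling_apply hinj, hT']
    · rw [extendFilling_of_not _ _ _ hc]
      have h1 : ¬ spoRank (T c) < 2 * n := fun h2 =>
        hc ((exists_cellInc h c).2 ⟨c.1, rfl, (hp c).1 h2⟩)
      rcases spoLetter_cases (T c) with ⟨b, hb⟩ | hb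
      · rw [hb] at h1
        exact absurd (spRank_lt b) h1
      · exact hb.symm

lemma spo_profile {k n : ℕ} {α : Fin k → ℕ} {T : Cell α → SpoLetter n 1} (hα : Antitone α)
    (hT : IsSpoTableau α T) :
    rowCount (fun a => spoRank a < 2 * n) T ∈ vertStrip α ∧
      ∀ c, spoRank (T c) < 2 * n ↔ (c.2 : ℕ) < rowCount (fun a => spoRank a < 2 * n) T c.1 := by
  rw [IsSpoTableau.iff_spoRank] at hT
  obtain ⟨hr, hc, hb⟩ := hT
  obtain ⟨u1, u2⟩ := rowCount_spec (p := fun a => spoRank a < 2 * n) (T := T)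
    fun c d h1 h2 _ => (hr c d h1 h2).2
  set κ := rowCount (fun a => spoRank a < 2 * n) T
  refine ⟨mem_vertStrip.2 ⟨fun i => ⟨?_, u1 i⟩, ?_⟩, u2⟩
  -- A row with two cells outside the unprimed part would contain `1'` twice.
  · by_contra hlt
    push Not at hlt
    have h1 := (hr ⟨i, ⟨κ i, by omega⟩⟩ ⟨i, ⟨α i - 1, by omega⟩⟩ rfl hlt).2
    exact lt_irrefl _ ((u2 _).1 h1)
  · intro i j hij
    rcases hij.eq_or_lt with rfl | hij'
    · exact le_rfl
    by_contra hlt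
    push Not at hlt
    have hj := u1 j
    have hi := hα hij
    have h1 := (u2 ⟨j, ⟨κ i, by omega⟩⟩).2 hlt
    have h2 := (hc ⟨i, ⟨κ i, by omega⟩⟩ ⟨j, ⟨κ i, by omega⟩⟩ rfl hij').2 h1
    exact lt_irrefl _ ((u2 _).1 (h2.trans h1))

open Classical in
lemma primed_weight {k n : ℕ} {α μ : Fin k → ℕ} (h : ∀ i, μ i ≤ α (id i)) (x : Fin n → Rˣ) (z : R) :
    (∏ c : Cell α, if ∃ d, cellInc id h d = c then 1
      else spoWeight x (fun _ : Fin 1 => z) primed) = ∏ i, z ^ (α i - μ i) := by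
  have hw : spoWeight x (fun _ : Fin 1 => z) primed = z := rfl
  simp only [hw, exists_cellInc]
  rw [Fintype.prod_sigma]
  refine Finset.prod_congr rfl fun i _ => ?_
  have := prod_threshold (a := α i) z z (h i) le_rfl
  simp only [ite_self, Nat.sub_self, pow_zero, mul_one, id] at this
  rw [← this]
  refine Finset.prod_congr rfl fun j _ => ?_
  congr 1
  simp

/-- Orthosymplectic Schur functions in terms of symplectic ones. -/
theorem spo_eq_sum_vertStrip {k n : ℕ} (α : Fin k → ℕ) (hα : Antitone α) (x : Fin n → Rˣ) (z : R) :
    spo α x (fun _ : Fin 1 => z) = ∑ μ ∈ vertStrip α, (∏ i, z ^ (α i - μ i)) * sp μ x := by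
  classical
  rw [spo, ← Finset.sum_fiberwise_of_maps_to
    (g := rowCount fun a : SpoLetter n 1 => spoRank a < 2 * n) (t := vertStrip α)
    fun T hT => (spo_profile hα (Finset.mem_filter.1 hT).2).1]
  refine Finset.sum_congr rfl fun μ hμ => ?_
  have h : ∀ i, μ i ≤ α (id i) := fun i => ((mem_vertStrip.1 hμ).1 i).2
  rw [← primed_weight h x z, sp]
  simp only [← spoWeight_spoEmbed x (fun _ => z)]
  rw [← sum_extendFilling (cellInc_injective Function.injective_id h) spoEmbed_injective
    (fun _ => primed) (spoWeight x (fun _ => z))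
    (fun T => IsSpoTableau α T ∧ ∀ c, spoRank (T c) < 2 * n ↔ (c.2 : ℕ) < μ c.1) (IsSpTableau μ)
    (fun T hT => isSpoTableau_extend hμ h hT) (fun T hT => exists_restrict_spo h hT.1 hT.2)]
  refine Finset.sum_congr (Finset.ext fun T => ?_) fun _ _ => rfl
  simp only [Finset.mem_filter, Finset.mem_univ, true_and]
  constructor
  · rintro ⟨h1, rfl⟩
    exact ⟨h1, (spo_profile hα h1).2⟩
  · rintro ⟨h1, h2⟩
    exact ⟨h1, funext fun i => rowCount_eq (h i) fun j => h2 ⟨i, j⟩⟩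

end Tableaux

/-! ### Bialternant formulas, symmetry and orthosymplectic branching. -/

section Bialternant

variable {R : Type*} [CommRing R]

/-- The Vandermonde product `∏_{i < j} (t i - t j)`. -/
def vandProd : {N : ℕ} → (Fin N → R) → R
  | 0, _ => 1
  | N + 1, t => (∏ i : Fin N, (t i.castSucc - t (Fin.last N))) * vandProd fun i => t i.castSucc

lemma vandProd_ne_zero [IsDomain R] {N : ℕ} (t : Fin N → R) (ht : Function.Injective t) :
    vandProd t ≠ 0 := by
  induction N with
  | zero => exact one_ne_zero
  | succ N ih =>
    refine mul_ne_zero (Finset.prod_ne_zero_iff.2 fun i _ => sub_ne_zero.2 fun h => ?_)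
      (ih _ (ht.comp (Fin.castSucc_injective N)))
    exact Fin.castSucc_ne_last i (ht h)

/-- The sequence `x i + (x i)⁻¹`. -/
def invSum {N : ℕ} (x : Fin N → Rˣ) (i : Fin N) : R := (x i : R) + ((x i)⁻¹ : Rˣ)

/-- Tableaux and determinants satisfy the same recursion in the last variable, the determinants with
an extra factor that builds up the Vandermonde product. -/
lemma sp_mul_vandProd {N : ℕ} (α : Fin N → ℕ) (hα : Antitone α) (x : Fin N → Rˣ) :
    sp α x * vandProd (invSum x) = altDet 0 α (invSum x) := by
  induction N with
  | zero =>
    have h : ∀ T : Cell α → SpLetter 0, IsSpTableau α T := fun T =>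
      ⟨fun c => c.1.elim0, fun c => c.1.elim0, fun c => c.1.elim0⟩
    simp [sp, vandProd, altDet, h]
  | succ N ih =>
    rw [altDet_branch (Units.mul_inv (x (Fin.last N))) 0 α hα _ rfl, sp_branch α hα, Finset.sum_mul,
      Finset.mul_sum]
    refine Finset.sum_congr rfl fun ν _ => ?_
    rw [Finset.sum_mul, Finset.mul_sum]
    refine Finset.sum_congr rfl fun μ hμ => ?_
    have := ih μ (antitone_of_mem_lowerStrip hμ) fun i => x i.castSucc
    have e : (fun i : Fin N => invSum x i.castSucc) = invSum fun i => x i.castSucc := rfl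
    rw [vandProd, e, ← this]
    simp only [invSum]
    ring

lemma add_le_of_strictAnti {N : ℕ} {v : Fin N → ℕ} (hv : StrictAnti v) (d : ℕ) :
    ∀ i j : Fin N, (j : ℕ) = i + d → v j + d ≤ v i := by
  induction d with
  | zero => intro i j h; rw [Fin.ext (a := j) (b := i) (by omega)]; omega
  | succ d ih =>
    intro i j h
    have h1 := ih i ⟨i + d, by omega⟩ rfl
    have h2 : v j < v ⟨i + d, by omega⟩ := hv (by rw [Fin.lt_def]; simp only []; omega)
    omega

/-- Expanding `u_l + z u_{l-1}` in every row lowers some of the shifted parts by one. A choice that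
does not come from a partition gives a zero row or two equal rows. -/
lemma altDet_eq_sum_vertStrip {N : ℕ} (z : R) (α : Fin N → ℕ) (hα : Antitone α) (t : Fin N → R) :
    altDet z α t = ∑ μ ∈ vertStrip α, (∏ i, z ^ (α i - μ i)) * altDet 0 μ t := by
  have h1 : altDet z α t = (Matrix.of fun j i : Fin N =>
      ∑ k ∈ Finset.Icc (α j + (N - j) - 1) (α j + (N - j)),
        z ^ (α j + (N - j) - k) * chebU (t i) k).det := by
    rw [altDet]
    congr 2
    ext j i
    obtain ⟨l, hl⟩ : ∃ l, α j + (N - j) = l + 1 := ⟨α j + (N - j) - 1, by have := j.isLt; omega⟩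
    have hI : Finset.Icc l (l + 1) = {l, l + 1} := by
      ext k; simp only [Finset.mem_Icc, Finset.mem_insert, Finset.mem_singleton]; omega
    rw [hl, Nat.add_sub_cancel, hI, Finset.sum_pair (by omega)]
    simp [chebV, add_comm]
  rw [h1, det_row_sum _ fun (j : Fin N) k i => z ^ (α j + (N - j) - k) * chebU (t i) k]
  symm
  refine Finset.sum_of_injOn (fun μ j => μ j + (N - j)) ?_ ?_ ?_ ?_
  · intro μ _ μ' _ h
    funext j
    have := congrFun h j
    simpa using this
  · intro μ hμ
    simp only [Finset.mem_coe, Fintype.mem_piFinset, Finset.mem_Icc] at hμ ⊢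
    intro j
    have := (mem_vertStrip.1 hμ).1 j
    omega
  · intro v hv hnot
    rw [Fintype.mem_piFinset] at hv
    simp only [Finset.mem_Icc] at hv
    by_contra hdet
    have hpos : ∀ j, 0 < v j := by
      intro j
      by_contra h0
      refine hdet (Matrix.det_eq_zero_of_row_eq_zero j fun i => ?_)
      have : v j = 0 := by omega
      simp [this, chebU]
    have hanti : StrictAnti v := by
      intro i j hij
      have h2 := hv i
      have h3 := hv j
      have h4 := hα hij.le
      have h5 : (i : ℕ) < j := hij
      have h6 := j.isLt
      have h7 : v i ≠ v j := by
        intro h7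
        have h8 := Matrix.det_mul_column (fun j : Fin N => z ^ (α j + (N - j) - v j))
          (Matrix.of fun j i : Fin N => chebU (t i) (v j))
        simp only [Matrix.of_apply] at h8
        rw [h8, Matrix.det_zero_of_row_eq hij.ne, mul_zero] at hdet
        · exact hdet rfl
        · funext k
          simp [h7]
      omega
    have hge : ∀ j : Fin N, N - j ≤ v j := by
      intro j
      have h2 := add_le_of_strictAnti hanti (N - 1 - j) j ⟨N - 1, by have := j.isLt; omega⟩
        (by have := j.isLt; simp only []; omega)
      have h3 := hpos ⟨N - 1, by have := j.isLt; omega⟩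
      omega
    refine hnot ⟨fun j => v j - (N - j), ?_, ?_⟩
    · rw [Finset.mem_coe, mem_vertStrip]
      refine ⟨fun j => ?_, fun i j hij => ?_⟩
      · have := hv j
        have := hge j
        omega
      · have h2 := add_le_of_strictAnti hanti (j - i) i j (by have : (i : ℕ) ≤ j := hij; omega)
        have h3 := hge i
        have h4 := hge j
        have h5 := j.isLt
        have : (i : ℕ) ≤ j := hij
        simp only []
        omega
    · funext j
      have := hge j
      simp only []
      omega
  · intro μ _
    simp only [Nat.add_sub_add_right]
    rw [altDet]
    simp only [chebV_zero_left]
    exact (Matrix.det_mul_column (fun j : Fin N => z ^ (α j - μ j))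
      (Matrix.of fun j i => chebU (t i) (μ j + (N - j)))).symm

/-- The bialternant formula for orthosymplectic Schur functions with one primed letter. -/
theorem spo_mul_vandProd {N : ℕ} (α : Fin N → ℕ) (hα : Antitone α) (x : Fin N → Rˣ) (z : R) :
    spo α x (fun _ : Fin 1 => z) * vandProd (invSum x) = altDet z α (invSum x) := by
  rw [spo_eq_sum_vertStrip α hα, altDet_eq_sum_vertStrip z α hα, Finset.sum_mul]
  refine Finset.sum_congr rfl fun μ hμ => ?_
  rw [mul_assoc, sp_mul_vandProd μ (mem_vertStrip.1 hμ).2]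

lemma spo_zero {k n m : ℕ} (x : Fin n → Rˣ) (y : Fin m → R) : spo (fun _ : Fin k => 0) x y = 1 := by
  have : IsEmpty (Cell fun _ : Fin k => 0) := ⟨fun c => c.2.elim0⟩
  have h : ∀ T : (Cell fun _ : Fin k => 0) → SpoLetter n m, IsSpoTableau _ T := fun T =>
    ⟨fun c => isEmptyElim c, fun c => isEmptyElim c, fun c => isEmptyElim c, fun c => isEmptyElim c,
      fun c => isEmptyElim c⟩
  simp [spo, h]

/-- Since `spo` of the empty shape is `1`, the Vandermonde product is itself an `altDet`; numerator
and denominator change by the same sign. -/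
lemma spo_comp_perm [IsDomain R] {N : ℕ} (α : Fin N → ℕ) (hα : Antitone α) (x : Fin N → Rˣ) (z : R)
    (hx : Function.Injective (invSum x)) (σ : Equiv.Perm (Fin N)) :
    spo α (x ∘ σ) (fun _ : Fin 1 => z) = spo α x (fun _ : Fin 1 => z) := by
  have e : invSum (x ∘ σ) = invSum x ∘ σ := rfl
  have h0 : ∀ x : Fin N → Rˣ, vandProd (invSum x) = altDet z (fun _ => 0) (invSum x) := fun x => by
    rw [← spo_mul_vandProd (fun _ => 0) antitone_const, spo_zero, one_mul]
  have hne : vandProd (invSum (x ∘ σ)) ≠ 0 := vandProd_ne_zero _ (by rw [e]; exact hx.comp σ.injective)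
  refine mul_right_cancel₀ hne ?_
  rw [spo_mul_vandProd α hα, h0, e, altDet_comp_perm, altDet_comp_perm, ← spo_mul_vandProd α hα, h0]
  ring

/-- Branching of the orthosymplectic Schur functions in the last unprimed variable. -/
theorem spo_branch [IsDomain R] {n : ℕ} (α : Fin (n + 1) → ℕ) (hα : Antitone α)
    (x : Fin (n + 1) → Rˣ) (z : R) (hx : Function.Injective (invSum x)) :
    spo α x (fun _ : Fin 1 => z) = ∑ ν ∈ upperStrip α, ∑ μ ∈ lowerStrip ν,
      branchWeight ((x (Fin.last n) : Rˣ) : R) (((x (Fin.last n))⁻¹ : Rˣ) : R) z α ν μ *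
        spo μ (fun i => x i.castSucc) (fun _ : Fin 1 => z) := by
  -- The letter `1'` comes after the last pair, so deleting that pair from tableaux is not direct;
  -- the recursion is imported from the determinants instead.
  refine mul_right_cancel₀ (vandProd_ne_zero _ hx) ?_
  rw [spo_mul_vandProd α hα, altDet_branch (Units.mul_inv (x (Fin.last n))) z α hα _ rfl,
    Finset.sum_mul, Finset.mul_sum]
  refine Finset.sum_congr rfl fun ν _ => ?_
  rw [Finset.sum_mul, Finset.mul_sum]
  refine Finset.sum_congr rfl fun μ hμ => ?_
  have := spo_mul_vandProd μ (antitone_of_mem_lowerStrip hμ) (fun i => x i.castSucc) z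
  have e : (fun i : Fin n => invSum x i.castSucc) = invSum fun i => x i.castSucc := rfl
  rw [vandProd, e, ← this]
  simp only [invSum]
  ring

end Bialternant

/-! ### The Cauchy-type identity, by moving variables between the two factors. -/

section Cauchy

variable {R : Type*} [CommRing R]

lemma mem_boxPartitions {n r : ℕ} {α : Fin n → ℕ} :
    α ∈ boxPartitions n r ↔ (∀ i, α i ≤ r) ∧ Antitone α := by
  simp [boxPartitions]

lemma prependRows_of_lt {n m r : ℕ} (α : Fin n → ℕ) {j : Fin m} (h : (j : ℕ) < m - n) :
    prependRows m r α j = r := dif_pos h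

lemma prependRows_of_eq {n m r : ℕ} (α : Fin n → ℕ) {i : Fin n} {j : Fin m}
    (h : (j : ℕ) = i + (m - n)) : prependRows m r α j = α i := by
  have h1 : ¬ (j : ℕ) < m - n := by omega
  rw [prependRows, dif_neg h1]
  congr 1
  exact Fin.ext (by simp only []; omega)

lemma prependRows_cases {n m : ℕ} (j : Fin m) :
    (j : ℕ) < m - n ∨ ∃ i : Fin n, (j : ℕ) = i + (m - n) := by
  by_cases h : (j : ℕ) < m - n
  · exact Or.inl h
  · exact Or.inr ⟨⟨j - (m - n), by have := j.isLt; omega⟩, by simp only []; omega⟩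

lemma prependRows_le {n m r : ℕ} {α : Fin n → ℕ} (hα : ∀ i, α i ≤ r) (j : Fin m) :
    prependRows m r α j ≤ r := by
  rcases prependRows_cases (n := n) j with h | ⟨i, h⟩
  · rw [prependRows_of_lt α h]
  · rw [prependRows_of_eq α h]; exact hα i

lemma antitone_prependRows {n m r : ℕ} {α : Fin n → ℕ} (hα : ∀ i, α i ≤ r) (hanti : Antitone α) :
    Antitone (prependRows m r α) := by
  intro j j' hj
  have hj' : (j : ℕ) ≤ j' := hj
  rcases prependRows_cases (n := n) j with h | ⟨i, h⟩
  · rw [prependRows_of_lt α h]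
    exact prependRows_le hα j'
  · rcases prependRows_cases (n := n) j' with h' | ⟨i', h'⟩
    · omega
    · rw [prependRows_of_eq α h, prependRows_of_eq α h']
      exact hanti (by rw [Fin.le_def]; omega)

lemma prod_prependRows {n m r : ℕ} (h : n ≤ m) (α : Fin n → ℕ) (f : ℕ → R) :
    ∏ j, f (prependRows m r α j) = f r ^ (m - n) * ∏ i, f (α i) := by
  obtain ⟨k, rfl⟩ := Nat.exists_eq_add_of_le' h
  rw [Fin.prod_univ_add, Nat.add_sub_cancel]
  congr 1
  · rw [Finset.prod_congr rfl (g := fun _ => f r)]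
    · simp
    · intro i _
      rw [prependRows_of_lt α (by simp)]
  · refine Finset.prod_congr rfl fun i _ => ?_
    rw [prependRows_of_eq α (i := i) (by simp; omega)]

/-- The last `n` entries of a sequence. -/
def lastRows {m : ℕ} (n : ℕ) (h : n ≤ m) (ρ : Fin m → ℕ) (i : Fin n) : ℕ :=
  ρ ⟨i + (m - n), by have := i.isLt; omega⟩

lemma lastRows_prependRows {n m r : ℕ} (h : n ≤ m) (α : Fin n → ℕ) :
    lastRows n h (prependRows m r α) = α := by
  funext i
  exact prependRows_of_eq α rfl

lemma prependRows_lastRows {n m r : ℕ} (h : n ≤ m) (ρ : Fin m → ℕ)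
    (hρ : ∀ j : Fin m, (j : ℕ) < m - n → ρ j = r) : prependRows m r (lastRows n h ρ) = ρ := by
  funext j
  rcases prependRows_cases (n := n) j with h1 | ⟨i, h1⟩
  · rw [prependRows_of_lt _ h1, hρ j h1]
  · rw [prependRows_of_eq _ h1, lastRows]
    congr 1
    exact Fin.ext h1.symm

/-- Prepending one more row to `μ` than to `ν` shifts the indices by one, so that the lower
neighbour of `ν` becomes its upper neighbour. This is half of the duality of chains. -/
lemma prependRows_mem_upperStrip {n m r : ℕ} (h : n + 1 ≤ m) {ν : Fin (n + 1) → ℕ} {μ : Fin n → ℕ} (hν : ∀ i, ν i ≤ r)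
    (hμ : μ ∈ lowerStrip ν) :
    prependRows (m + 1) r ν ∈ upperStrip (prependRows (m + 1) r μ) := by
  rw [mem_lowerStrip] at hμ
  rw [mem_upperStrip]
  constructor
  · intro j
    rcases prependRows_cases (n := n) j with h1 | ⟨i, h1⟩
    · rw [prependRows_of_lt μ h1]; exact prependRows_le hν j
    · rw [prependRows_of_eq μ h1, prependRows_of_eq ν (i := i.succ) (by simp; omega)]
      exact (hμ i).1
  · intro j
    rcases prependRows_cases (n := n) j.succ with h1 | ⟨i, h1⟩
    · rw [prependRows_of_lt μ h1, prependRows_of_lt ν (by simp at h1 ⊢; omega)]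
    · rw [prependRows_of_eq μ h1,
        prependRows_of_eq ν (i := i.castSucc) (by simp at h1 ⊢; omega)]
      exact (hμ i).2

lemma prependRows_mem_lowerStrip {n m r : ℕ} (h : n + 1 ≤ m) {α ν : Fin (n + 1) → ℕ} (hα : ∀ i, α i ≤ r)
    (hν : ν ∈ upperStrip α) : prependRows m r α ∈ lowerStrip (prependRows (m + 1) r ν) := by
  rw [mem_upperStrip] at hν
  have hνr : ∀ i, ν i ≤ r := fun i => (hν.1 i).trans (hα i)
  rw [mem_lowerStrip]
  intro j
  constructor
  · rcases prependRows_cases (n := n + 1) j with h1 | ⟨i, h1⟩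
    · rw [prependRows_of_lt α h1]; exact prependRows_le hνr _
    · rw [prependRows_of_eq α h1, prependRows_of_eq ν (i := i) (by simp; omega)]
      exact hν.1 i
  · rcases prependRows_cases (n := n + 1) j.castSucc with h1 | ⟨i, h1⟩
    · rw [prependRows_of_lt ν h1]
      exact prependRows_le hα _
    · have hi := i.isLt
      have hj := j.isLt
      rw [Fin.val_castSucc] at h1
      rw [prependRows_of_eq ν h1, prependRows_of_eq α (i := (⟨i, by omega⟩ : Fin n).succ)
        (by simp; omega)]
      exact hν.2 ⟨i, by omega⟩

lemma lastRows_mem {n m r : ℕ} (h : n + 1 ≤ m) {κ : Fin n → ℕ} {ν : Fin (m + 1) → ℕ} {ρ : Fin m → ℕ}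
    (hκ : κ ∈ boxPartitions n r) (hν : ν ∈ upperStrip (prependRows (m + 1) r κ))
    (hρ : ρ ∈ lowerStrip ν) :
    lastRows (n + 1) h ρ ∈ boxPartitions (n + 1) r ∧
      lastRows (n + 1) (h.trans (Nat.le_succ m)) ν ∈ upperStrip (lastRows (n + 1) h ρ) ∧
      κ ∈ lowerStrip (lastRows (n + 1) (h.trans (Nat.le_succ m)) ν) := by
  have hanti := antitone_of_mem_lowerStrip hρ
  rw [mem_boxPartitions] at hκ ⊢
  rw [mem_upperStrip] at hν ⊢
  rw [mem_lowerStrip] at hρ ⊢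
  have hsub : m + 1 - (n + 1) = m - (n + 1) + 1 := by omega
  refine ⟨⟨fun i => ?_, fun i i' hi => hanti ?_⟩, ⟨fun i => ?_, fun i => ?_⟩, fun i => ⟨?_, ?_⟩⟩
  · exact ((hρ _).2.trans (hν.1 _)).trans (prependRows_le hκ.1 _)
  · simpa using hi
  · refine le_trans (le_of_eq ?_) (hρ _).1
    exact congrArg ν (Fin.ext (by simp; omega))
  · refine (hρ _).2.trans (le_of_eq ?_)
    exact congrArg ν (Fin.ext (by simp; omega))
  · refine (hν.1 _).trans (le_of_eq (prependRows_of_eq κ ?_))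
    simp; omega
  · refine le_trans (le_of_eq (prependRows_of_eq κ (j := Fin.succ ⟨i + (m - n), ?_⟩) ?_).symm)
      ((hν.2 _).trans (le_of_eq (congrArg ν (Fin.ext ?_))))
    · omega
    · simp; omega
    · simp

/-- Each interlacing step below a shape bounded by `r` can release only one of its leading rows of
length `r`; hence discarding leading rows loses nothing. -/
lemma eq_of_mem_strips {n m r : ℕ} (h : n + 1 ≤ m) {κ : Fin n → ℕ} {ν : Fin (m + 1) → ℕ} {ρ : Fin m → ℕ}
    (hκ : κ ∈ boxPartitions n r) (hν : ν ∈ upperStrip (prependRows (m + 1) r κ))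
    (hρ : ρ ∈ lowerStrip ν) :
    (∀ j : Fin (m + 1), (j : ℕ) < m + 1 - (n + 1) → ν j = r) ∧
      ∀ j : Fin m, (j : ℕ) < m - (n + 1) → ρ j = r := by
  rw [mem_boxPartitions] at hκ
  rw [mem_upperStrip] at hν
  rw [mem_lowerStrip] at hρ
  have hνr : ∀ j, ν j ≤ r := fun j => (hν.1 j).trans (prependRows_le hκ.1 j)
  have h1 : ∀ j : Fin (m + 1), (j : ℕ) < m + 1 - (n + 1) → ν j = r := by
    intro j hj
    refine le_antisymm (hνr j) ?_
    have h2 := hν.2 ⟨j, by omega⟩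
    rw [prependRows_of_lt κ (by simp; omega)] at h2
    exact h2
  refine ⟨h1, fun j hj => le_antisymm ((hρ j).2.trans (hνr _)) ?_⟩
  rw [← h1 j.succ (by simp; omega)]
  exact (hρ j).1

/-- The weight is symmetric in the outer shapes, and the added rows cancel: `m - n` of them in `ν`
count twice, against `m - n + 1` and `m - n - 1` in the other two. The last part of `ν` is
untouched, so the factor in `z` survives. -/
lemma branchWeight_prependRows {n m r : ℕ} (h : n + 1 ≤ m) {x y : R} (hxy : x * y = 1) (z : R) (α ν : Fin (n + 1) → ℕ)
    (μ : Fin n → ℕ) :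
    branchWeight x y z (prependRows (m + 1) r μ) (prependRows (m + 1) r ν) (prependRows m r α) =
      branchWeight x y z α ν μ := by
  have hlast : prependRows (m + 1) r ν (Fin.last m) = ν (Fin.last n) :=
    prependRows_of_eq ν (by simp; omega)
  have e : ∀ k, x ^ k * y ^ k = 1 := fun k => by rw [← mul_pow, hxy, one_pow]
  rw [branchWeight, branchWeight, hlast]
  simp only [Finset.prod_mul_distrib]
  rw [prod_prependRows (by omega) ν fun k => x ^ (2 * k), prod_prependRows (by omega) μ fun k => y ^ k,
    prod_prependRows h α fun k => y ^ k, show m + 1 - n = (m - (n + 1)) + 2 by omega,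
    show m + 1 - (n + 1) = (m - (n + 1)) + 1 by omega, ← pow_mul, ← pow_mul, ← pow_mul]
  have e1 := e (2 * r * (m - (n + 1) + 1))
  have e2 : y ^ (r * (m - (n + 1) + 2)) * y ^ (r * (m - (n + 1))) =
    y ^ (2 * r * (m - (n + 1) + 1)) := by rw [← pow_add]; congr 1; ring
  generalize (if ν (Fin.last n) = 0 then (1 : R) else 1 + z * y) = c
  rw [← e2] at e1
  linear_combination ((∏ i, x ^ (2 * ν i)) * (∏ i, y ^ α i) * (∏ i, y ^ μ i) * c) * e1

/-- The Cauchy-type identity, over a domain in which all `w i + (w i)⁻¹` are distinct. -/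
lemma sum_spo_mul_spo_of_isDomain [IsDomain R] (r : ℕ) (z : R) {N : ℕ} (w : Fin N → Rˣ)
    (hw : Function.Injective (invSum w)) (n : ℕ) : ∀ m, n ≤ m → ∀ e : Fin n ⊕ Fin m ≃ Fin N,
    ∑ α ∈ boxPartitions n r, spo α (fun i => w (e (Sum.inl i))) (fun _ : Fin 1 => z) *
        spo (prependRows m r α) (fun j => w (e (Sum.inr j))) (fun _ : Fin 1 => z) =
      spo (fun _ : Fin N => r) w (fun _ : Fin 1 => z) := by
  induction n with
  | zero =>
    intro m _ e
    obtain rfl : m = N := by simpa using Fintype.card_congr e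
    have hbox : boxPartitions 0 r = {fun _ => 0} := by
      ext α
      simp only [mem_boxPartitions, Finset.mem_singleton]
      exact ⟨fun _ => Subsingleton.elim _ _, fun _ => ⟨fun i => i.elim0, fun i => i.elim0⟩⟩
    have hpre : prependRows m r (fun _ : Fin 0 => 0) = fun _ => r := by
      funext j
      exact prependRows_of_lt _ (by simp)
    rw [hbox, Finset.sum_singleton, spo_zero, one_mul, hpre]
    -- Only here is symmetry used: the moves have left the variables in the order given by `e`.
    exact spo_comp_perm _ antitone_const w z hw ((Equiv.emptySum (Fin 0) (Fin m)).symm.trans e)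
  | succ n ih =>
    intro m hm e
    -- The last variable of the first group becomes the last of the second, so that both branchings
    -- remove the same variable.
    obtain ⟨e', he1, he2, he3⟩ : ∃ e' : Fin n ⊕ Fin (m + 1) ≃ Fin N,
        (∀ i, e' (Sum.inl i) = e (Sum.inl i.castSucc)) ∧
        (∀ j : Fin m, e' (Sum.inr j.castSucc) = e (Sum.inr j)) ∧
        e' (Sum.inr (Fin.last m)) = e (Sum.inl (Fin.last n)) := by
      set f : Fin n ⊕ Fin (m + 1) → Fin N := Sum.elim (fun i => e (Sum.inl i.castSucc))
        (Fin.snoc (α := fun _ => Fin N) (fun j => e (Sum.inr j)) (e (Sum.inl (Fin.last n)))) with hf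
      have hinj : Function.Injective f := by
        rintro (i | i) (j | j)
        · simp [hf]
        · refine Fin.lastCases ?_ (fun j => ?_) j <;> simp [hf, Fin.castSucc_ne_last]
        · refine Fin.lastCases ?_ (fun i => ?_) i <;> simp [hf, (Fin.castSucc_ne_last _).symm]
        · refine Fin.lastCases ?_ (fun i => ?_) i <;> refine Fin.lastCases ?_ (fun j => ?_) j <;>
            simp [hf]
      have hcard : Fintype.card (Fin n ⊕ Fin (m + 1)) = Fintype.card (Fin N) := by
        rw [← Fintype.card_congr e]
        simp
        omega
      refine ⟨Equiv.ofBijective f ((Fintype.bijective_iff_injective_and_card f).2 ⟨hinj, hcard⟩),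
        fun i => rfl, fun j => ?_, ?_⟩ <;> simp [hf]
    rw [← ih (m + 1) (by omega) e']
    have hx : Function.Injective (invSum fun i => w (e (Sum.inl i))) :=
      hw.comp (e.injective.comp Sum.inl_injective)
    have hy : Function.Injective (invSum fun j => w (e' (Sum.inr j))) :=
      hw.comp (e'.injective.comp Sum.inr_injective)
    have hl : ∑ α ∈ boxPartitions (n + 1) r,
        spo α (fun i => w (e (Sum.inl i))) (fun _ : Fin 1 => z) *
          spo (prependRows m r α) (fun j => w (e (Sum.inr j))) (fun _ : Fin 1 => z) = _ :=
      Finset.sum_congr rfl fun α hα => by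
        rw [spo_branch α (mem_boxPartitions.1 hα).2 _ z hx, Finset.sum_sigma', Finset.sum_mul]
    have hr : ∑ κ ∈ boxPartitions n r,
        spo κ (fun i => w (e' (Sum.inl i))) (fun _ : Fin 1 => z) *
          spo (prependRows (m + 1) r κ) (fun j => w (e' (Sum.inr j))) (fun _ : Fin 1 => z) = _ :=
      Finset.sum_congr rfl fun κ hκ => by
        rw [spo_branch (prependRows (m + 1) r κ) (antitone_prependRows (mem_boxPartitions.1 hκ).1
          (mem_boxPartitions.1 hκ).2) _ z hy, Finset.sum_sigma', Finset.mul_sum]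
    rw [hl, hr, Finset.sum_sigma', Finset.sum_sigma']
    refine Finset.sum_nbij'
      (fun p => ⟨p.2.2, ⟨prependRows (m + 1) r p.2.1, prependRows m r p.1⟩⟩)
      (fun p => ⟨lastRows (n + 1) hm p.2.2,
        ⟨lastRows (n + 1) (hm.trans (Nat.le_succ m)) p.2.1, p.1⟩⟩) ?_ ?_ ?_ ?_ ?_
    · rintro ⟨α, ν, μ⟩ hp
      simp only [Finset.mem_sigma] at hp ⊢
      obtain ⟨h1, h2, h3⟩ := hp
      rw [mem_boxPartitions] at h1
      have hν : ∀ i, ν i ≤ r := fun i => ((mem_upperStrip.1 h2).1 i).trans (h1.1 i)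
      refine ⟨mem_boxPartitions.2 ⟨fun i => ?_, antitone_of_mem_lowerStrip h3⟩,
        prependRows_mem_upperStrip hm hν h3, prependRows_mem_lowerStrip hm h1.1 h2⟩
      exact (mem_lowerStrip.1 h3 i).2.trans (hν _)
    · rintro ⟨κ, ν, ρ⟩ hp
      simp only [Finset.mem_sigma] at hp ⊢
      obtain ⟨h1, h2, h3⟩ := hp
      exact lastRows_mem hm h1 h2 h3
    · rintro ⟨α, ν, μ⟩ _
      simp only [lastRows_prependRows]
    · rintro ⟨κ, ν, ρ⟩ hp
      simp only [Finset.mem_sigma] at hp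
      obtain ⟨h1, h2, h3⟩ := hp
      obtain ⟨h4, h5⟩ := eq_of_mem_strips hm h1 h2 h3
      simp only [prependRows_lastRows _ _ h4, prependRows_lastRows _ _ h5]
    · rintro ⟨α, ν, μ⟩ _
      simp only [he1, he2, he3]
      rw [branchWeight_prependRows hm (Units.mul_inv _)]
      ring

lemma map_spo {S : Type*} [CommRing S] (f : R →+* S) {k n m : ℕ} (α : Fin k → ℕ) (x : Fin n → Rˣ)
    (y : Fin m → R) :
    f (spo α x y) = spo α (fun i => Units.map (f : R →* S) (x i)) (fun j => f (y j)) := by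
  rw [spo, spo, map_sum]
  refine Finset.sum_congr rfl fun T _ => ?_
  rw [map_prod]
  refine Finset.prod_congr rfl fun c _ => ?_
  unfold spoWeight spWeight
  rcases ofLex (T c) with a | j
  · rcases h : ofLex a with ⟨i, b⟩
    cases b <;> simp [h, ← map_inv]
  · rfl

open MvPolynomial in
/-- Every family of units and every further element is the image of a generic one. -/
lemma exists_generic {N : ℕ} (w : Fin N → Rˣ) (z : R) :
    ∃ (A : Type) (_ : CommRing A) (_ : IsDomain A) (f : A →+* R) (W : Fin N → Aˣ) (Z : A),
      Function.Injective (invSum W) ∧ (∀ i, Units.map (f : A →* R) (W i) = w i) ∧ f Z = z := by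
  let P := MvPolynomial (Option (Fin N)) ℤ
  let D : P := ∏ i : Fin N, X (some i)
  have hD : D ≠ 0 := Finset.prod_ne_zero_iff.2 fun i _ => X_ne_zero _
  have hle : Submonoid.powers D ≤ nonZeroDivisors P :=
    powers_le_nonZeroDivisors_of_noZeroDivisors hD
  have hdom : IsDomain (Localization.Away D) := IsLocalization.isDomain_localization hle
  have hinj : Function.Injective (algebraMap P (Localization.Away D)) :=
    IsLocalization.injective _ hle
  have hunit : ∀ i : Fin N, IsUnit (algebraMap P (Localization.Away D) (X (some i))) := fun i =>
    isUnit_of_dvd_unit (map_dvd _ (Finset.dvd_prod_of_mem (fun i : Fin N => (X (some i) : P))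
      (Finset.mem_univ i))) (IsLocalization.Away.algebraMap_isUnit D)
  let g : P →+* R := eval₂Hom (Int.castRingHom R) fun o => o.elim z fun i => (w i : R)
  have hgX : ∀ o, g (X o) = o.elim z fun i => (w i : R) := fun o => eval₂Hom_X' _ _ _
  have hg : IsUnit (g D) := by
    have : g D = ((∏ i, w i : Rˣ) : R) := by
      rw [map_prod, Units.coe_prod]
      exact Finset.prod_congr rfl fun i _ => hgX (some i)
    rw [this]
    exact Units.isUnit _
  refine ⟨Localization.Away D, inferInstance, hdom, IsLocalization.Away.lift D hg,
    fun i => (hunit i).unit, algebraMap P _ (X none), ?_, fun i => ?_, ?_⟩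
  · intro i j hij
    by_contra hne
    -- Clearing denominators in `a + a⁻¹ = b + b⁻¹` gives `(a - b) * (a * b - 1) = 0`; the second
    -- factor is nonzero, having constant term `-1`.
    have h1 : (X (some i) - X (some j)) * (X (some i) * X (some j) - 1) = (0 : P) := by
      have key : ∀ a b : (Localization.Away D)ˣ, (a : Localization.Away D) + (a⁻¹ : _ˣ) =
          b + (b⁻¹ : _ˣ) → ((a : Localization.Away D) - b) * (a * b - 1) = 0 := fun a b h => by
        linear_combination (a : Localization.Away D) * b * h - (b : Localization.Away D) * a.mul_inv +
          (a : Localization.Away D) * b.mul_inv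
      apply hinj
      rw [map_zero, map_mul, map_sub, map_sub, map_mul, map_one]
      exact key _ _ hij
    rcases mul_eq_zero.1 h1 with h2 | h2
    · exact hne (Option.some_injective _ (X_injective (sub_eq_zero.1 h2)))
    · have := congrArg (eval fun _ => (0 : ℤ)) h2
      simp at this
  · ext
    simp only [Units.coe_map, MonoidHom.coe_coe, IsUnit.unit_spec]
    rw [IsLocalization.Away.lift_eq]
    exact hgX (some i)
  · rw [IsLocalization.Away.lift_eq]
    exact hgX none

/-- The Cauchy-type identity for orthosymplectic Schur functions with one primed letter. -/
theorem sum_spo_mul_spo {n m : ℕ} (h : n ≤ m) (r : ℕ) (x : Fin n → Rˣ) (y : Fin m → Rˣ) (z : R) :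
    ∑ α ∈ boxPartitions n r, spo α x (fun _ : Fin 1 => z) *
        spo (prependRows m r α) y (fun _ : Fin 1 => z) =
      spo (fun _ : Fin (n + m) => r) (Fin.append x y) (fun _ : Fin 1 => z) := by
  obtain ⟨A, _, _, f, W, Z, hW, hw, rfl⟩ := exists_generic (Fin.append x y) z
  have key := congrArg f (sum_spo_mul_spo_of_isDomain r Z W hW n m h finSumFinEquiv)
  rw [map_sum, map_spo] at key
  simp only [map_mul, map_spo, hw, finSumFinEquiv_apply_left, finSumFinEquiv_apply_right,
    Fin.append_left, Fin.append_right] at key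
  exact key

end Cauchy

/-! ### Expansion of the rectangular orthosymplectic function. -/

section Rectangle

variable {R : Type*} [CommRing R]

lemma prod_pow_rectangle {N r j : ℕ} (hj : 1 ≤ j) (hjN : j ≤ N + 1) (hr : 0 < r) (z : R) :
    ∏ i : Fin N, z ^ (r - if (i : ℕ) < j - 1 then r else r - 1) = z ^ (N + 1 - j) := by
  have := prod_threshold (a := N) (m := j - 1) z z (by omega) le_rfl
  simp only [ite_self, Nat.sub_self, pow_zero, mul_one] at this
  rw [show N + 1 - j = N - (j - 1) by omega, ← this]
  refine Finset.prod_congr rfl fun i _ => ?_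
  split_ifs with h1
  · simp
  · rw [show r - (r - 1) = 1 by omega, pow_one]

/-- Orthosymplectic Schur functions of rectangles in terms of symplectic ones. -/
lemma pow_mul_spo_rectangle (N r : ℕ) (w : Fin N → Rˣ) (z : R) :
    z ^ r * spo (fun _ : Fin N => r) w (fun _ : Fin 1 => z) =
      ∑ j ∈ Finset.Icc 1 (N + 1), z ^ (r + N + 1 - j) *
        spInt (fun i : Fin N => if (i : ℕ) < j - 1 then (r : ℤ) else (r : ℤ) - 1) w := by
  rcases Nat.eq_zero_or_pos r with rfl | hr
  · rw [spo_zero, Finset.sum_eq_single (N + 1)]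
    · have e : (fun i : Fin N => if (i : ℕ) < N + 1 - 1 then ((0 : ℕ) : ℤ) else ((0 : ℕ) : ℤ) - 1) =
          fun _ => 0 := by
        funext i
        rw [if_pos (by simp)]
        rfl
      rw [e, spInt, if_pos ⟨antitone_const, fun _ => le_rfl⟩]
      have : sp (fun _ : Fin N => (0 : ℤ).toNat) w = 1 := by
        have h1 := spo_eq_sum_vertStrip (fun _ : Fin N => 0) antitone_const w (1 : R)
        have h2 : vertStrip (fun _ : Fin N => 0) = {fun _ => 0} := by
          ext μ
          simp only [mem_vertStrip, Finset.mem_singleton]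
          constructor
          · intro h
            funext i
            have := (h.1 i).2
            omega
          · rintro rfl
            exact ⟨fun _ => ⟨by simp, le_rfl⟩, antitone_const⟩
        rw [h2, Finset.sum_singleton, spo_zero] at h1
        simpa using h1.symm
      rw [this]
      simp
    -- For `r = 0`, entry `j - 1` of every other sequence is `-1`, so only `j = N + 1` contributes.
    · intro j hj hne
      rw [Finset.mem_Icc] at hj
      rw [spInt, if_neg, mul_zero]
      rintro ⟨_, h⟩
      have := h ⟨j - 1, by omega⟩
      simp at this
    · intro h
      simp at h
  · rw [spo_eq_sum_vertStrip _ antitone_const, Finset.mul_sum]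
    symm
    have hμ : ∀ j, ∀ i : Fin N, (if (i : ℕ) < j - 1 then (r : ℤ) else (r : ℤ) - 1) =
        ((if (i : ℕ) < j - 1 then r else r - 1 : ℕ) : ℤ) := by
      intro j i
      split_ifs
      · rfl
      · omega
    have hanti : ∀ j, Antitone fun i : Fin N => if (i : ℕ) < j - 1 then r else r - 1 := by
      intro j i i' hi
      have : (i : ℕ) ≤ i' := hi
      dsimp only
      split_ifs <;> omega
    refine Finset.sum_nbij (fun j (i : Fin N) => if (i : ℕ) < j - 1 then r else r - 1) ?_ ?_ ?_ ?_
    · intro j _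
      refine mem_vertStrip.2 ⟨fun i => ?_, hanti j⟩
      split_ifs <;> omega
    · intro j hj j' hj' h
      simp only [Finset.coe_Icc, Set.mem_Icc] at hj hj'
      rcases lt_trichotomy j j' with hlt | heq | hlt
      · have := congrFun h ⟨j - 1, by omega⟩
        simp only [lt_irrefl, if_false] at this
        rw [if_pos (by omega)] at this
        omega
      · exact heq
      · have := congrFun h ⟨j' - 1, by omega⟩
        simp only [lt_irrefl, if_false] at this
        rw [if_pos (by omega)] at this
        omega
    · intro μ hm
      obtain ⟨h1, h2⟩ := mem_vertStrip.1 hm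
      -- The parts of `μ` are `r` or `r - 1` and decrease weakly, so the number of parts equal to
      -- `r` determines `μ`.
      obtain ⟨m, hmN, hm'⟩ := exists_threshold (fun i => μ i = r) fun i j hij hj => by
        have h3 := h2 hij.le
        have h4 := (h1 i).2
        omega
      refine ⟨m + 1, by simp; omega, ?_⟩
      funext i
      have h3 := h1 i
      have h4 := hm' i
      simp only [Nat.add_sub_cancel]
      split_ifs with h5
      · exact (h4.2 h5).symm
      · have : μ i ≠ r := fun h6 => h5 (h4.1 h6)
        omega
    · intro j hj
      rw [Finset.mem_Icc] at hj
      simp only [hμ]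
      rw [prod_pow_rectangle hj.1 hj.2 hr, ← mul_assoc, ← pow_add,
        show r + N + 1 - j = r + (N + 1 - j) by omega, spInt, if_pos]
      · simp only [Int.toNat_natCast]
      · exact ⟨fun i i' hi => Int.ofNat_le.2 (hanti j hi), fun i => Int.natCast_nonneg _⟩

end Rectangle

end OrthoSymp

end

theorem theorem4 {R : Type*} [CommRing R] (n m r : ℕ) (hn : 0 < n) (hnm : n ≤ m)
    (x : Fin n → Rˣ) (y : Fin m → Rˣ) (z : R) :
    ∑ α ∈ OrthoSymp.boxPartitions n r,
        z ^ r * OrthoSymp.spo α x (fun _ : Fin 1 => z) *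
          OrthoSymp.spo (OrthoSymp.prependRows m r α) y (fun _ : Fin 1 => z) =
      ∑ j ∈ Finset.Icc 1 (n + m + 1),
        z ^ (r + n + m + 1 - j) *
          OrthoSymp.spInt (fun i : Fin (n + m) => if (i : ℕ) < j - 1 then (r : ℤ) else (r : ℤ) - 1)
            (Fin.append x y) := by
  simp only [mul_assoc, add_assoc r n m]
  rw [← Finset.mul_sum, OrthoSymp.sum_spo_mul_spo hnm, OrthoSymp.pow_mul_spo_rectangle]
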